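/- Let $I=(a,b)$ be a bounded open interval with $a<b$, let $1\le p<\infty$, and let $F\in C^1([a,b],\mathbb R)$ satisfy $F(a)=0$ and $F(x)\neq 0$ for all $x\in(a,b)$. Assume that for every $x_0\in I$ the initial value problem $\dot x=F(x)$, $x(0)=x_0$, has a solution $\varphi(\cdot,x_0)$ with values in $I$ that is defined on all of $[0,\infty)$. For $y\in\varphi(t,I)$ write $\varphi(-t,y)$ for the unique point of $I$ with $\varphi(t,\varphi(-t,y))=y$. Let $h\in C([a,b])\cap W^{1,\infty}(I)$ be such that the function $y\mapsto\frac{h(y)-h(a)}{F(y)}$ belongs to $L^\infty(I)$. On $W^{1,p}(I)=\{u\in L^p(I): u'\in L^p(I)\}$, where $u'$ is the distributional derivative and $\|u\|_{1,p}=\|u\|_p+\|u'\|_p$, let $$(S_{F,h}(t)u)(x)=\exp\Big(\int_0^t h(\varphi(s,x))\,ds\Big)\,u(\varphi(t,x)),\qquad t\ge 0,$$ and let $W^{1,p}_*(I)=\{u\in W^{1,p}(I): u(a)=0\}$, where $u(a)$ is the value at $a$ of the representative of $u$ that is continuous on $[a,b]$. The semigroup $S_{F,h}$ is called stable on $X\in\{W^{1,p}(I),W^{1,p}_*(I)\}$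 if $\lim_{t\to\infty}\|S_{F,h}(t)u\|_{1,p}=0$ for every $u\in X$. Put $$E(y,z)=\int_y^z\frac{h(a)-\left(\frac1p-1\right)F'(s)}{F(s)}\,ds,\qquad y,z\in I.$$ 1. Suppose that $\varphi(t,I)=I$ for every $t>0$. Then $S_{F,h}$ is stable on $W^{1,p}_*(I)$ if and only if (a) there is $C\in\mathbb R$ such that $E(y,\varphi(t,y))\le C$ for a.e. $y\in I$ and all $t\ge 0$; and (b) $\lim_{t\to+\infty}E(\varphi(-t,y),y)=-\infty$ for every $y\in I$. Moreover, if $S_{F,h}$ is stable on $W^{1,p}_*(I)$, then also $\lim_{t\to+\infty}E(y,\varphi(t,y))=-\infty$ for every $y\in I$. 2. Suppose that for every $x\in I$ there is $\overline t>0$ with $x\notin\varphi(\overline t,I)$. Then $S_{F,h}$ is stable on $W^{1,p}_*(I)$ if and only if there is $C\in\mathbb R$ such that $E(y,\varphi(t,y))\le C$ for a.e. $y\in I$ and all $t\ge0$. 3. In all cases, $S_{F,h}$ is stable on $W^{1,p}(I)$ if and only if it is stable on $W^{1,p}_*(I)$ and $h(a)<0$. -/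

import Mathlib

open Set Filter Topology MeasureTheory

noncomputable section

/-- `φ` restricted to `[0,∞) × Ω` is the semiflow of `x' = F x` on `Ω`: for every starting point
`x ∈ Ω` the curve `t ↦ φ t x` stays in `Ω` for all `t ≥ 0` and solves the initial value problem.
For `F` of class `C¹` this determines `φ` on `[0,∞) × Ω`, and the existence of `φ` says that the
maximal solutions in `Ω` are defined on all of `[0,∞)`. -/
structure IsSemiflowOf (F : ℝ → ℝ) (Ω : Set ℝ) (φ : ℝ → ℝ → ℝ) : Prop where
  init : ∀ x ∈ Ω, φ 0 x = x
  mem : ∀ x ∈ Ω, ∀ t : ℝ, 0 ≤ t → φ t x ∈ Ω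
  ode : ∀ x ∈ Ω, ∀ t : ℝ, 0 ≤ t →
    HasDerivWithinAt (fun s => φ s x) (F (φ t x)) (Ici 0) t

/-- The point `φ(-t, y)`: the preimage of `y` under the injective map `φ(t, ·)` on `Ω`
(meaningful for `y ∈ φ(t, Ω)`). -/
def backFlow (φ : ℝ → ℝ → ℝ) (Ω : Set ℝ) (t y : ℝ) : ℝ :=
  Function.invFunOn (φ t) Ω y

/-- The weighted composition operators `(S(t) u)(x) = exp (∫₀ᵗ h (φ(s,x)) ds) u (φ(t,x))`. -/
def weightedComp (φ : ℝ → ℝ → ℝ) (h : ℝ → ℝ) (t : ℝ) (u : ℝ → ℝ) : ℝ → ℝ :=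
  fun x => Real.exp (∫ s in (0 : ℝ)..t, h (φ s x)) * u (φ t x)

/-- `v` is the distributional derivative of `u` on the open set `Ω`. -/
def IsWeakDeriv (Ω : Set ℝ) (u v : ℝ → ℝ) : Prop :=
  LocallyIntegrableOn u Ω volume ∧ LocallyIntegrableOn v Ω volume ∧
    ∀ ψ : ℝ → ℝ, ContDiff ℝ (⊤ : ℕ∞) ψ → HasCompactSupport ψ → tsupport ψ ⊆ Ω →
      ∫ x in Ω, u x * deriv ψ x = - ∫ x in Ω, v x * ψ x

/-- Membership in the Sobolev space `W^{1,p}(Ω)` (functions, regarded up to equality a.e.). -/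
def MemSobolev (Ω : Set ℝ) (p : ENNReal) (u : ℝ → ℝ) : Prop :=
  MemLp u p (volume.restrict Ω) ∧
    ∃ v : ℝ → ℝ, IsWeakDeriv Ω u v ∧ MemLp v p (volume.restrict Ω)

/-- The Sobolev norm `‖u‖_p + ‖u'‖_p` with values in `[0,∞]`. The distributional derivative is
unique up to equality a.e., so the infimum runs over a single value; it is `∞` if `u` has no
locally integrable distributional derivative. -/
def sobolevENorm (Ω : Set ℝ) (p : ENNReal) (u : ℝ → ℝ) : ENNReal :=
  ⨅ (v : ℝ → ℝ) (_ : IsWeakDeriv Ω u v),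
    eLpNorm u p (volume.restrict Ω) + eLpNorm v p (volume.restrict Ω)

/-- Membership in `W^{1,p}_*(a,b)`, the kernel of the point evaluation at `a`: the
representative of `u` that is continuous on `[a,b]` vanishes at `a`. -/
def MemSobolevStar (a b : ℝ) (p : ENNReal) (u : ℝ → ℝ) : Prop :=
  MemSobolev (Ioo a b) p u ∧
    ∃ g : ℝ → ℝ, ContinuousOn g (Icc a b) ∧ u =ᵐ[volume.restrict (Ioo a b)] g ∧ g a = 0

/-- Stability of the semigroup `S_{F,h}` on `W^{1,p}(a,b)`, where `φ` is the semiflow of `F`. -/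
def StableOnSobolev (a b : ℝ) (p : ENNReal) (φ : ℝ → ℝ → ℝ) (h : ℝ → ℝ) : Prop :=
  ∀ u : ℝ → ℝ, MemSobolev (Ioo a b) p u →
    Tendsto (fun t : ℝ => sobolevENorm (Ioo a b) p (weightedComp φ h t u)) atTop (𝓝 0)

/-- Stability of the semigroup `S_{F,h}` on `W^{1,p}_*(a,b)`, where `φ` is the semiflow of `F`. -/
def StableOnSobolevStar (a b : ℝ) (p : ENNReal) (φ : ℝ → ℝ → ℝ) (h : ℝ → ℝ) : Prop :=
  ∀ u : ℝ → ℝ, MemSobolevStar a b p u →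
    Tendsto (fun t : ℝ => sobolevENorm (Ioo a b) p (weightedComp φ h t u)) atTop (𝓝 0)

/-- The integral `∫_y^z (h(a) - (1/p - 1) F'(s)) / F(s) ds`. -/
def sobolevExponent (a p : ℝ) (F h : ℝ → ℝ) (y z : ℝ) : ℝ :=
  ∫ s in y..z, (h a - (1 / p - 1) * deriv F s) / F s

end

/-! The weight first reduces to a constant. With k = (h - h(a))/F bounded and K a primitive of k,
integration along an orbit gives ∫₀ᵗ h(φ(s,x)) ds = t h(a) + K(φ(t,x)) - K(x). Hence S_{F,h} is
conjugate, through multiplication by exp(±K), to the semigroup with constant weight h(a). These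
multipliers preserve both Sobolev spaces (`exists_conjugation`, `stable_iff_stable_const`).

Travel time T, a primitive of 1/F, turns the flow into a translation: T(φ(t,x)) = T(x) + t. It
follows that φ(t,·) is an injective open map with derivative F(φ(t,x))/F(x) > 0, and that E(y,z) =
h(a)(T(z) - T(y)) + (1 - 1/p)(log|F(z)| - log|F(y)|).

For u vanishing at a, so does S(t)u, and a Poincaré inequality leaves only the derivative to
control. Substituting y = φ(t,x), its L^p norm is that of w_t u', where w_t(y) = exp E(φ(-t,y), y)
on φ(t,I) and 0 elsewhere (`eLpNorm_pullbackDeriv`). Every L^p function is such a u', so stability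
on W^{1,p}_* means that multiplication by w_t tends strongly to 0 on L^p
(`stableOnSobolevStar_const_iff`).

A uniform bound on w_t together with pointwise decay suffices, by dominated convergence. Conversely,
strong decay forces the bound by a gliding hump. It forces pointwise decay because w_t at y is
comparable to w_t on a whole open set of points just downstream of y. If backward orbits leave I,
then w_t(y) is eventually 0 and the bound alone decides.

Finally, W^{1,p} is W^{1,p}_* plus the constants, and under the constant weight h(a) constants decay
exactly when h(a) < 0. -/

/-! ### Primitives and weak derivatives on an interval -/

/-- `G` is a primitive on `(a, b)` of the locally integrable function `w`. -/
def IsPrimitiveOn (a b : ℝ) (G w : ℝ → ℝ) : Prop :=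
  LocallyIntegrableOn w (Ioo a b) volume ∧
    ∀ x ∈ Ioo a b, ∀ y ∈ Ioo a b, G y - G x = ∫ s in x..y, w s

theorem LocallyIntegrableOn.intervalIntegrable_of_mem_Ioo {a b : ℝ} {w : ℝ → ℝ}
    (hw : LocallyIntegrableOn w (Ioo a b) volume) {x y : ℝ} (hx : x ∈ Ioo a b)
    (hy : y ∈ Ioo a b) : IntervalIntegrable w volume x y :=
  (intervalIntegrable_iff.2 ((hw.integrableOn_compact_subset
    (ordConnected_Ioo.uIcc_subset hx hy) isCompact_uIcc).mono_set uIoc_subset_uIcc))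

theorem LocallyIntegrableOn.mul_continuousOn_Ioo {a b : ℝ} {w m : ℝ → ℝ}
    (hw : LocallyIntegrableOn w (Ioo a b) volume) (hm : ContinuousOn m (Ioo a b)) :
    LocallyIntegrableOn (fun x => w x * m x) (Ioo a b) volume := by
  rw [locallyIntegrableOn_iff isOpen_Ioo.isLocallyClosed] at hw ⊢
  exact fun k hk hc => (hw k hk hc).mul_continuousOn (hm.mono hk) hc

/-- On a compact subinterval `G` differs from an indefinite integral of `w` by a constant, so
absolute continuity and Lebesgue differentiation carry over. -/
theorem IsPrimitiveOn.absolutelyContinuousOnInterval {a b : ℝ} {G w : ℝ → ℝ}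
    (h : IsPrimitiveOn a b G w) {x y : ℝ} (hx : x ∈ Ioo a b) (hy : y ∈ Ioo a b) :
    AbsolutelyContinuousOnInterval G x y ∧ ∀ᵐ s, s ∈ uIcc x y → HasDerivAt G (w s) s := by
  have hw := LocallyIntegrableOn.intervalIntegrable_of_mem_Ioo h.1 hx hy
  have hsub := ordConnected_Ioo.uIcc_subset hx hy
  constructor
  · have h1 := hw.absolutelyContinuousOnInterval_intervalIntegral (c := x) left_mem_uIcc
    rw [absolutelyContinuousOnInterval_iff] at h1 ⊢
    intro ε hε
    obtain ⟨δ, hδ, H⟩ := h1 ε hε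
    refine ⟨δ, hδ, fun E hE hE' => ?_⟩
    convert! H E hE hE' using 1
    refine Finset.sum_congr rfl fun i hi => ?_
    have h2 := hE.1 i hi
    have e1 := h.2 x hx _ (hsub h2.1)
    have e2 := h.2 x hx _ (hsub h2.2)
    rw [← e1, ← e2, Real.dist_eq, Real.dist_eq]
    congr 1
    ring
  · filter_upwards [hw.ae_hasDerivAt_integral] with s hs hs'
    have h1 := (hs hs' x left_mem_uIcc).const_add (G x)
    refine h1.congr_of_eventuallyEq ?_
    filter_upwards [isOpen_Ioo.mem_nhds (hsub hs')] with z hz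
    rw [← h.2 x hx z hz]
    ring

theorem IsPrimitiveOn.continuousOn {a b : ℝ} {G w : ℝ → ℝ}
    (h : IsPrimitiveOn a b G w) : ContinuousOn G (Ioo a b) := by
  intro x hx
  have h1 : (x + a) / 2 ∈ Ioo a b := ⟨by linarith [hx.1], by linarith [hx.1, hx.2]⟩
  have h2 : (x + b) / 2 ∈ Ioo a b := ⟨by linarith [hx.1, hx.2], by linarith [hx.2]⟩
  have h3 := (h.absolutelyContinuousOnInterval h1 h2).1.continuousOn
  refine (h3.continuousAt ?_).continuousWithinAt
  rw [uIcc_of_le (by linarith [hx.1, hx.2])]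
  exact Icc_mem_nhds (by linarith [hx.1]) (by linarith [hx.2])

theorem isPrimitiveOn_of_hasDerivAt {a b : ℝ} {m m' : ℝ → ℝ}
    (hm : ∀ x ∈ Ioo a b, HasDerivAt m (m' x) x) (hc : ContinuousOn m' (Ioo a b)) :
    IsPrimitiveOn a b m m' := by
  refine ⟨hc.locallyIntegrableOn measurableSet_Ioo, fun x hx y hy => ?_⟩
  have hsub := ordConnected_Ioo.uIcc_subset hx hy
  rw [intervalIntegral.integral_eq_sub_of_hasDerivAt (fun z hz => hm z (hsub hz))
    ((hc.mono hsub).intervalIntegrable)]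

theorem IsPrimitiveOn.mul {a b : ℝ} {G w m m' : ℝ → ℝ}
    (h : IsPrimitiveOn a b G w) (hm : IsPrimitiveOn a b m m') :
    IsPrimitiveOn a b (fun x => m x * G x) (fun x => m' x * G x + m x * w x) := by
  constructor
  · refine LocallyIntegrableOn.add
      (LocallyIntegrableOn.mul_continuousOn_Ioo hm.1 h.continuousOn) ?_
    simpa only [mul_comm] using LocallyIntegrableOn.mul_continuousOn_Ioo h.1 hm.continuousOn
  · intro x hx y hy
    obtain ⟨h1, h2⟩ := h.absolutelyContinuousOnInterval hx hy
    obtain ⟨h3, h4⟩ := hm.absolutelyContinuousOnInterval hx hy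
    rw [← h3.integral_deriv_mul_eq_sub h1]
    refine intervalIntegral.integral_congr_ae ?_
    filter_upwards [h2, h4] with s hs hs' hs''
    rw [(hs (uIoc_subset_uIcc hs'')).deriv, (hs' (uIoc_subset_uIcc hs'')).deriv]

/-- Applied to supports of test functions: it supplies end points inside `(a, b)` where boundary
terms vanish and between which locally integrable functions are integrable. -/
theorem exists_Ioo_of_isCompact_subset_Ioo {a b : ℝ} (hab : a < b) {K : Set ℝ} (hK : IsCompact K)
    (hKI : K ⊆ Ioo a b) : ∃ α ∈ Ioo a b, ∃ β ∈ Ioo a b, α < β ∧ K ⊆ Ioo α β := by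
  rcases K.eq_empty_or_nonempty with rfl | hne
  · exact ⟨(2 * a + b) / 3, ⟨by linarith, by linarith⟩, (a + 2 * b) / 3,
      ⟨by linarith, by linarith⟩, by linarith, empty_subset _⟩
  · obtain ⟨m, hm, hm'⟩ := hK.exists_isLeast hne
    obtain ⟨M, hM, hM'⟩ := hK.exists_isGreatest hne
    have h1 := hKI hm
    have h2 := hKI hM
    have h3 := hm' hM
    exact ⟨(a + m) / 2, ⟨by linarith [h1.1], by linarith [h1.1, h1.2]⟩, (M + b) / 2,
      ⟨by linarith [h2.1, h2.2], by linarith [h2.2]⟩, by linarith [h1.1, h2.2],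
      fun x hx => ⟨by linarith [h1.1, hm' hx], by linarith [h2.2, hM' hx]⟩⟩

theorem setIntegral_Ioo_eq_intervalIntegral {a b α β : ℝ} (hα : α ∈ Ioo a b) (hβ : β ∈ Ioo a b)
    (hαβ : α < β) {f : ℝ → ℝ} (hf : ∀ x, x ∉ Ioo α β → f x = 0) :
    ∫ x in Ioo a b, f x = ∫ x in α..β, f x := by
  rw [intervalIntegral.integral_of_le hαβ.le,
    setIntegral_eq_integral_of_forall_compl_eq_zero (fun x hx => hf x fun h => hx (Ioo_subset_Ioc_self h)),
    setIntegral_eq_integral_of_forall_compl_eq_zero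
      (fun x hx => hf x fun h => hx (Ioo_subset_Ioo hα.1.le hβ.2.le h))]

theorem LocallyIntegrableOn.integrableOn_mul_of_tsupport_subset {a b : ℝ} {u ψ : ℝ → ℝ}
    (hu : LocallyIntegrableOn u (Ioo a b) volume) (hψ : Continuous ψ)
    (hc : HasCompactSupport ψ) (hs : tsupport ψ ⊆ Ioo a b) :
    IntegrableOn (fun x => u x * ψ x) (Ioo a b) := by
  have h1 := (hu.integrableOn_compact_subset hs hc).mul_continuousOn hψ.continuousOn hc
  rw [integrableOn_iff_integrable_of_support_subset] at h1
  · exact h1.integrableOn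
  · intro x hx
    exact subset_tsupport _ (right_ne_zero_of_mul hx)

/-- Integration by parts: `ψ * G` is a primitive of `ψ' * G + ψ * w` and vanishes at both end points
of an interval around the support of `ψ`. -/
theorem IsPrimitiveOn.isWeakDeriv {a b : ℝ} {G w : ℝ → ℝ} (h : IsPrimitiveOn a b G w) :
    IsWeakDeriv (Ioo a b) G w := by
  have hG := h.continuousOn.locallyIntegrableOn (μ := volume) measurableSet_Ioo
  refine ⟨hG, h.1, fun ψ hψ hc hs => ?_⟩
  rcases le_or_gt b a with hba | hab
  · simp [Ioo_eq_empty_of_le hba]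
  obtain ⟨α, hα, β, hβ, hαβ, hsub⟩ := exists_Ioo_of_isCompact_subset_Ioo hab hc hs
  have hz : ∀ x, x ∉ Ioo α β → ψ x = 0 := fun x hx =>
    image_eq_zero_of_notMem_tsupport fun h => hx (hsub h)
  have hz' : ∀ x, x ∉ Ioo α β → deriv ψ x = 0 := fun x hx =>
    image_eq_zero_of_notMem_tsupport fun h => hx (hsub (tsupport_deriv_subset h))
  have hψ' : Continuous (deriv ψ) := hψ.continuous_deriv (by simp)
  have h1 := (h.mul (isPrimitiveOn_of_hasDerivAt
    (fun x _ => (hψ.differentiable (by simp)).differentiableAt.hasDerivAt)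
      hψ'.continuousOn)).2 α hα β hβ
  beta_reduce at h1
  rw [hz α (by simp), hz β (by simp), zero_mul, zero_mul, sub_zero,
    ← setIntegral_Ioo_eq_intervalIntegral hα hβ hαβ
      (fun x hx => by rw [hz x hx, hz' x hx]; simp)] at h1
  have i1 := LocallyIntegrableOn.integrableOn_mul_of_tsupport_subset hG hψ' hc.deriv
    (tsupport_deriv_subset.trans hs)
  have i2 := LocallyIntegrableOn.integrableOn_mul_of_tsupport_subset h.1 hψ.continuous hc hs
  have h2 : ∫ x in Ioo a b, (deriv ψ x * G x + ψ x * w x) =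
      (∫ x in Ioo a b, G x * deriv ψ x) + ∫ x in Ioo a b, w x * ψ x := by
    rw [← integral_add i1 i2]
    congr 1 with x
    ring
  linarith

theorem IsWeakDeriv.congr_ae {Ω : Set ℝ} {u u' v : ℝ → ℝ} (h : IsWeakDeriv Ω u v)
    (hu : u =ᵐ[volume.restrict Ω] u') : IsWeakDeriv Ω u' v := by
  refine ⟨fun x hx => ?_, h.2.1, fun ψ h1 h2 h3 => ?_⟩
  · obtain ⟨t, ht, ht'⟩ := h.1 x hx
    refine ⟨t ∩ Ω, inter_mem ht self_mem_nhdsWithin, ?_⟩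
    exact (ht'.mono_set inter_subset_left).congr_fun_ae
      (ae_mono (Measure.restrict_mono inter_subset_right le_rfl) hu)
  · rw [← h.2.2 ψ h1 h2 h3]
    refine integral_congr_ae ?_
    filter_upwards [hu] with x hx
    rw [hx]

theorem ae_eq_zero_of_forall_integral_mul_eq_zero {a b : ℝ} {w : ℝ → ℝ}
    (hw : LocallyIntegrableOn w (Ioo a b) volume)
    (h : ∀ ψ : ℝ → ℝ, ContDiff ℝ (⊤ : ℕ∞) ψ → HasCompactSupport ψ → tsupport ψ ⊆ Ioo a b →
      ∫ x in Ioo a b, w x * ψ x = 0) : w =ᵐ[volume.restrict (Ioo a b)] 0 := by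
  rw [EventuallyEq, ae_restrict_iff' measurableSet_Ioo]
  refine isOpen_Ioo.ae_eq_zero_of_integral_contDiff_smul_eq_zero hw fun ψ h1 h2 h3 => ?_
  rw [← h ψ h1 h2 h3, setIntegral_eq_integral_of_forall_compl_eq_zero]
  · simp [mul_comm]
  · intro x hx
    rw [image_eq_zero_of_notMem_tsupport fun h => hx (h3 h), mul_zero]

theorem IsWeakDeriv.ae_eq {a b : ℝ} {u v v' : ℝ → ℝ} (h : IsWeakDeriv (Ioo a b) u v)
    (h' : IsWeakDeriv (Ioo a b) u v') : v =ᵐ[volume.restrict (Ioo a b)] v' := by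
  have h1 := ae_eq_zero_of_forall_integral_mul_eq_zero (h.2.1.sub h'.2.1) fun ψ h1 h2 h3 => by
    have i1 := LocallyIntegrableOn.integrableOn_mul_of_tsupport_subset h.2.1 h1.continuous h2 h3
    have i2 := LocallyIntegrableOn.integrableOn_mul_of_tsupport_subset h'.2.1 h1.continuous h2 h3
    simp only [Pi.sub_apply, sub_mul]
    rw [integral_sub i1 i2]
    linarith [h.2.2 ψ h1 h2 h3, h'.2.2 ψ h1 h2 h3]
  filter_upwards [h1] with x hx
  simpa [sub_eq_zero] using hx

/-- A test function on an interval with vanishing integral is the derivative of a test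
function. -/
theorem exists_testFunction_deriv_eq {a b : ℝ} (hab : a < b) {f : ℝ → ℝ}
    (hf : ContDiff ℝ (⊤ : ℕ∞) f) (hc : HasCompactSupport f) (hs : tsupport f ⊆ Ioo a b)
    (h0 : ∫ x in Ioo a b, f x = 0) :
    ∃ ψ : ℝ → ℝ, ContDiff ℝ (⊤ : ℕ∞) ψ ∧ HasCompactSupport ψ ∧ tsupport ψ ⊆ Ioo a b ∧
      deriv ψ = f := by
  obtain ⟨α, hα, β, hβ, hαβ, hsub⟩ := exists_Ioo_of_isCompact_subset_Ioo hab hc hs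
  have hz : ∀ x, x ∉ Ioo α β → f x = 0 := fun x hx =>
    image_eq_zero_of_notMem_tsupport fun h => hx (hsub h)
  have hd : ∀ x, HasDerivAt (fun x => ∫ s in α..x, f s) (f x) x := fun x =>
    intervalIntegral.integral_hasDerivAt_right (hf.continuous.intervalIntegrable _ _)
      (hf.continuous.stronglyMeasurableAtFilter _ _) hf.continuous.continuousAt
  have hd' : deriv (fun x => ∫ s in α..x, f s) = f := funext fun x => (hd x).deriv
  have h0' : ∫ s in α..β, f s = 0 := by
    rw [← setIntegral_Ioo_eq_intervalIntegral hα hβ hαβ hz, h0]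
  have hsupp : tsupport (fun x => ∫ s in α..x, f s) ⊆ Icc α β := by
    refine closure_minimal (fun x hx => ?_) isClosed_Icc
    by_contra hx'
    refine hx ?_
    rcases lt_or_ge x α with h | h
    · refine intervalIntegral.integral_zero_ae (ae_of_all _ fun s hs => hz s fun hs' => ?_)
      rw [uIoc_of_ge h.le] at hs
      exact absurd hs.2 (not_le.2 hs'.1)
    · have h : β < x := by
        by_contra h'
        exact hx' ⟨h, not_lt.1 h'⟩
      have h3 : ∫ s in β..x, f s = 0 := by
        refine intervalIntegral.integral_zero_ae (ae_of_all _ fun s hs => hz s fun hs' => ?_)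
        rw [uIoc_of_le h.le] at hs
        exact absurd hs.1 (not_lt.2 hs'.2.le)
      have h4 := intervalIntegral.integral_add_adjacent_intervals
        (hf.continuous.intervalIntegrable (μ := volume) α β)
        (hf.continuous.intervalIntegrable (μ := volume) β x)
      change ∫ s in α..x, f s = 0
      rw [← h4, h0', h3, add_zero]
  refine ⟨fun x => ∫ s in α..x, f s, ?_, isCompact_Icc.of_isClosed_subset (isClosed_tsupport _)
    hsupp, hsupp.trans (Icc_subset_Ioo hα.1 hβ.2), hd'⟩
  exact contDiff_infty_iff_deriv.2 ⟨fun x => (hd x).differentiableAt, by rwa [hd']⟩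

/-- **Du Bois-Reymond lemma** on an interval. -/
theorem exists_ae_eq_const_of_forall_integral_mul_deriv_eq_zero {a b : ℝ} (hab : a < b)
    {w : ℝ → ℝ} (hw : LocallyIntegrableOn w (Ioo a b) volume)
    (h : ∀ ψ : ℝ → ℝ, ContDiff ℝ (⊤ : ℕ∞) ψ → HasCompactSupport ψ → tsupport ψ ⊆ Ioo a b →
      ∫ x in Ioo a b, w x * deriv ψ x = 0) :
    ∃ c, w =ᵐ[volume.restrict (Ioo a b)] fun _ => c := by
  let B : ContDiffBump ((a + b) / 2) :=
    ⟨(b - a) / 8, (b - a) / 4, by linarith, by linarith⟩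
  set θ : ℝ → ℝ := B.normed volume with hθ
  have hθs : tsupport θ ⊆ Ioo a b := by
    rw [hθ, B.tsupport_normed_eq, Real.closedBall_eq_Icc]
    refine Icc_subset_Ioo ?_ ?_ <;> simp only [B] <;> linarith
  have hθc : HasCompactSupport θ := B.hasCompactSupport_normed
  have hθd : ContDiff ℝ (⊤ : ℕ∞) θ := B.contDiff_normed
  have hθi : ∫ x in Ioo a b, θ x = 1 := by
    rw [setIntegral_eq_integral_of_forall_compl_eq_zero
      (fun x hx => image_eq_zero_of_notMem_tsupport fun h => hx (hθs h)), hθ, B.integral_normed]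
  set c := ∫ x in Ioo a b, w x * θ x with hc
  have hl : LocallyIntegrableOn (fun _ : ℝ => c) (Ioo a b) volume :=
    continuousOn_const.locallyIntegrableOn measurableSet_Ioo
  refine ⟨c, ?_⟩
  -- Subtracting from a test function `χ` its integral times the normalized bump `θ` leaves mean
  -- zero, hence the derivative of a test function; so `w` sees only the integral of `χ`.
  have h1 := ae_eq_zero_of_forall_integral_mul_eq_zero (hw.sub hl) fun χ h1 h2 h3 => by
    have iχ : IntegrableOn χ (Ioo a b) := (h1.continuous.integrable_of_hasCompactSupport h2).integrableOn
    have iθ : IntegrableOn θ (Ioo a b) :=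
      (hθd.continuous.integrable_of_hasCompactSupport hθc).integrableOn
    have i1 := LocallyIntegrableOn.integrableOn_mul_of_tsupport_subset hw h1.continuous h2 h3
    have i2 := LocallyIntegrableOn.integrableOn_mul_of_tsupport_subset hw hθd.continuous hθc hθs
    set κ := ∫ x in Ioo a b, χ x with hκ
    have hcs : HasCompactSupport (fun x => κ * θ x) := hθc.mul_left
    have hts : tsupport (fun x => χ x - κ * θ x) ⊆ Ioo a b := by
      refine (tsupport_sub χ (fun x => κ * θ x)).trans (union_subset h3 ?_)
      exact (closure_mono fun x hx => right_ne_zero_of_mul hx).trans hθs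
    obtain ⟨ψ, p1, p2, p3, p4⟩ := exists_testFunction_deriv_eq hab
      (f := fun x => χ x - κ * θ x) (h1.sub (contDiff_const.mul hθd)) (h2.sub hcs) hts (by
        rw [integral_sub iχ (iθ.const_mul κ), integral_const_mul, hθi]; ring)
    have h5 := h ψ p1 p2 p3
    rw [p4] at h5
    have h6 : ∫ x in Ioo a b, w x * (χ x - κ * θ x) =
        (∫ x in Ioo a b, w x * χ x) - κ * c := by
      rw [hc, ← integral_const_mul, ← integral_sub i1 (i2.const_mul κ)]
      congr 1 with x
      ring
    simp only [Pi.sub_apply, sub_mul]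
    rw [integral_sub i1 (iχ.const_mul c), integral_const_mul]
    linarith
  filter_upwards [h1] with x hx
  simpa [sub_eq_zero] using hx

/-- The difference of `u` and an indefinite integral of `v` has weak derivative zero, so it is
constant by Du Bois-Reymond. -/
theorem IsWeakDeriv.exists_isPrimitiveOn {a b : ℝ} (hab : a < b) {u v : ℝ → ℝ}
    (h : IsWeakDeriv (Ioo a b) u v) :
    ∃ G, u =ᵐ[volume.restrict (Ioo a b)] G ∧ IsPrimitiveOn a b G v := by
  have hm : (a + b) / 2 ∈ Ioo a b := ⟨by linarith, by linarith⟩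
  have hG : IsPrimitiveOn a b (fun x => ∫ s in (a + b) / 2..x, v s) v := by
    refine ⟨h.2.1, fun x hx y hy => ?_⟩
    rw [intervalIntegral.integral_interval_sub_left]
    exacts [LocallyIntegrableOn.intervalIntegrable_of_mem_Ioo h.2.1 hm hy,
      LocallyIntegrableOn.intervalIntegrable_of_mem_Ioo h.2.1 hm hx]
  have hGw := hG.isWeakDeriv
  obtain ⟨c, hc⟩ := exists_ae_eq_const_of_forall_integral_mul_deriv_eq_zero hab
    (h.1.sub hGw.1) fun ψ h1 h2 h3 => by
      have i1 := LocallyIntegrableOn.integrableOn_mul_of_tsupport_subset h.1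
        (h1.continuous_deriv (by simp)) h2.deriv (tsupport_deriv_subset.trans h3)
      have i2 := LocallyIntegrableOn.integrableOn_mul_of_tsupport_subset hGw.1
        (h1.continuous_deriv (by simp)) h2.deriv (tsupport_deriv_subset.trans h3)
      simp only [Pi.sub_apply, sub_mul]
      rw [integral_sub i1 i2, h.2.2 ψ h1 h2 h3, hGw.2.2 ψ h1 h2 h3, sub_self]
  refine ⟨fun x => (∫ s in (a + b) / 2..x, v s) + c, ?_, h.2.1, fun x hx y hy => ?_⟩
  · filter_upwards [hc] with x hx
    simp only [Pi.sub_apply] at hx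
    linarith
  · rw [← hG.2 x hx y hy]
    ring

theorem IsPrimitiveOn.comp {a b : ℝ} {G w f f' : ℝ → ℝ} (h : IsPrimitiveOn a b G w)
    (hf : ∀ x ∈ Ioo a b, HasDerivAt f (f' x) x) (hpos : ∀ x ∈ Ioo a b, 0 < f' x)
    (hinj : InjOn f (Ioo a b)) (hmaps : MapsTo f (Ioo a b) (Ioo a b)) :
    IsPrimitiveOn a b (fun x => G (f x)) (fun x => w (f x) * f' x) := by
  have hc : ContinuousOn f (Ioo a b) := fun x hx => (hf x hx).continuousAt.continuousWithinAt
  constructor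
  · rw [locallyIntegrableOn_iff isOpen_Ioo.isLocallyClosed]
    intro k hk hkc
    have h1 := h.1.integrableOn_compact_subset ((image_mono hk).trans hmaps.image_subset)
      (hkc.image_of_continuousOn (hc.mono hk))
    rw [integrableOn_image_iff_integrableOn_abs_deriv_smul hkc.measurableSet
      (fun x hx => (hf x (hk hx)).hasDerivWithinAt) (hinj.mono hk)] at h1
    refine h1.congr_fun (fun x hx => ?_) hkc.measurableSet
    simp [abs_of_pos (hpos x (hk hx)), mul_comm]
  · intro x hx y hy
    have hsub := ordConnected_Ioo.uIcc_subset hx hy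
    have hsub' : Ioo (min x y) (max x y) ⊆ Ioo a b := Ioo_subset_Icc_self.trans hsub
    rw [h.2 _ (hmaps hx) _ (hmaps hy), ← intervalIntegral.integral_comp_mul_deriv_of_deriv_nonneg
      (hc.mono hsub) (fun z hz => hf z (hsub' hz)) (fun z hz => (hpos z (hsub' hz)).le)]
    rfl

/-! ### The semiflow in the travel time coordinate -/

/-- `φ` is the semiflow on `(a, b)` of a `C¹` vector field on `[a, b]` that vanishes at `a` and has
no zero in `(a, b)`. -/
structure IsRegularSemiflow (a b : ℝ) (F : ℝ → ℝ) (φ : ℝ → ℝ → ℝ) : Prop where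
  lt : a < b
  contDiffOn : ContDiffOn ℝ 1 F (Icc a b)
  left_eq_zero : F a = 0
  ne_zero : ∀ x ∈ Ioo a b, F x ≠ 0
  isSemiflowOf : IsSemiflowOf F (Ioo a b) φ

/-- The time needed by the flow of `F` to go from the midpoint of `(a, b)` to `x`. -/
noncomputable def travelTime (a b : ℝ) (F : ℝ → ℝ) (x : ℝ) : ℝ := ∫ s in (a + b) / 2..x, (F s)⁻¹

namespace IsRegularSemiflow

variable {a b : ℝ} {F : ℝ → ℝ} {φ : ℝ → ℝ → ℝ}

theorem mid_mem (H : IsRegularSemiflow a b F φ) : (a + b) / 2 ∈ Ioo a b :=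
  ⟨by linarith [H.lt], by linarith [H.lt]⟩

theorem mem (H : IsRegularSemiflow a b F φ) {x t : ℝ} (hx : x ∈ Ioo a b) (ht : 0 ≤ t) :
    φ t x ∈ Ioo a b := H.isSemiflowOf.mem x hx t ht

theorem continuousOn (H : IsRegularSemiflow a b F φ) : ContinuousOn F (Ioo a b) :=
  H.contDiffOn.continuousOn.mono Ioo_subset_Icc_self

theorem hasDerivAt (H : IsRegularSemiflow a b F φ) {x : ℝ} (hx : x ∈ Ioo a b) :
    HasDerivAt F (deriv F x) x :=
  ((H.contDiffOn.differentiableOn (by simp)).differentiableAt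
    (Icc_mem_nhds hx.1 hx.2)).hasDerivAt

theorem continuousOn_deriv (H : IsRegularSemiflow a b F φ) :
    ContinuousOn (deriv F) (Ioo a b) :=
  (H.contDiffOn.mono Ioo_subset_Icc_self).continuousOn_deriv_of_isOpen isOpen_Ioo (by simp)

theorem exists_deriv_bound (H : IsRegularSemiflow a b F φ) :
    ∃ L, 0 ≤ L ∧ ∀ x ∈ Ioo a b, |deriv F x| ≤ L ∧ |F x| ≤ L * (x - a) := by
  obtain ⟨L, hL⟩ := isCompact_Icc.exists_bound_of_continuousOn
    (H.contDiffOn.continuousOn_derivWithin (uniqueDiffOn_Icc H.lt) le_rfl)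
  refine ⟨L, (norm_nonneg _).trans (hL a (left_mem_Icc.2 H.lt.le)), fun x hx => ⟨?_, ?_⟩⟩
  · have := hL x (Ioo_subset_Icc_self hx)
    rwa [derivWithin_of_mem_nhds (Icc_mem_nhds hx.1 hx.2)] at this
  · have := (convex_Icc a b).norm_image_sub_le_of_norm_derivWithin_le
      (H.contDiffOn.differentiableOn (by simp)) hL (left_mem_Icc.2 H.lt.le)
      (Ioo_subset_Icc_self hx)
    rwa [H.left_eq_zero, sub_zero, Real.norm_eq_abs, Real.norm_eq_abs,
      abs_of_pos (sub_pos.2 hx.1)] at this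

theorem exists_log_le (H : IsRegularSemiflow a b F φ) :
    ∃ B, ∀ x ∈ Ioo a b, Real.log (F x) ≤ B := by
  obtain ⟨M, hM⟩ := isCompact_Icc.exists_bound_of_continuousOn H.contDiffOn.continuousOn
  refine ⟨Real.log M, fun x hx => ?_⟩
  rw [← Real.log_abs]
  exact Real.log_le_log (abs_pos.2 (H.ne_zero x hx)) (hM x (Ioo_subset_Icc_self hx))

theorem div_pos (H : IsRegularSemiflow a b F φ) {x y : ℝ} (hx : x ∈ Ioo a b)
    (hy : y ∈ Ioo a b) : 0 < F y / F x := by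
  have key : ∀ u ∈ Ioo a b, ∀ v ∈ Ioo a b, F u < 0 → 0 < F v → False := fun u hu v hv h1 h2 => by
    obtain ⟨z, hz, hz'⟩ := isPreconnected_Ioo.intermediate_value hu hv H.continuousOn
      ⟨h1.le, h2.le⟩
    exact H.ne_zero z hz hz'
  rcases lt_or_gt_of_ne (H.ne_zero x hx) with h | h <;>
    rcases lt_or_gt_of_ne (H.ne_zero y hy) with h' | h'
  · exact div_pos_of_neg_of_neg h' h
  · exact (key x hx y hy h h').elim
  · exact (key y hy x hx h' h).elim
  · exact _root_.div_pos h' h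

/-- `Real.log` is log|·|, so the formula needs only that `F` has constant sign, whichever it is. -/
theorem div_eq_exp (H : IsRegularSemiflow a b F φ) {x y : ℝ} (hx : x ∈ Ioo a b)
    (hy : y ∈ Ioo a b) : F y / F x = Real.exp (Real.log (F y) - Real.log (F x)) := by
  rw [← Real.log_div (H.ne_zero y hy) (H.ne_zero x hx), Real.exp_log (H.div_pos hx hy)]

theorem hasStrictDerivAt_travelTime (H : IsRegularSemiflow a b F φ) {x : ℝ} (hx : x ∈ Ioo a b) :
    HasStrictDerivAt (travelTime a b F) (F x)⁻¹ x := by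
  have hc : ContinuousOn (fun s => (F s)⁻¹) (Ioo a b) := H.continuousOn.inv₀ H.ne_zero
  exact intervalIntegral.integral_hasStrictDerivAt_right
    ((hc.mono (ordConnected_Ioo.uIcc_subset H.mid_mem hx)).intervalIntegrable)
    (hc.stronglyMeasurableAtFilter isOpen_Ioo x hx) (hc.continuousAt (isOpen_Ioo.mem_nhds hx))

theorem hasDerivAt_travelTime (H : IsRegularSemiflow a b F φ) {x : ℝ} (hx : x ∈ Ioo a b) :
    HasDerivAt (travelTime a b F) (F x)⁻¹ x := (H.hasStrictDerivAt_travelTime hx).hasDerivAt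

theorem continuousOn_travelTime (H : IsRegularSemiflow a b F φ) :
    ContinuousOn (travelTime a b F) (Ioo a b) := fun _ hx =>
  (H.hasDerivAt_travelTime hx).continuousAt.continuousWithinAt

theorem injOn_travelTime (H : IsRegularSemiflow a b F φ) : InjOn (travelTime a b F) (Ioo a b) := by
  have key : ∀ x ∈ Ioo a b, ∀ y ∈ Ioo a b, x < y → travelTime a b F x ≠ travelTime a b F y := by
    intro x hx y hy hxy he
    have hsub : Icc x y ⊆ Ioo a b := Icc_subset_Ioo hx.1 hy.2
    obtain ⟨z, hz, hz'⟩ := exists_hasDerivAt_eq_zero hxy (H.continuousOn_travelTime.mono hsub) he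
      fun z hz => H.hasDerivAt_travelTime (hsub (Ioo_subset_Icc_self hz))
    exact inv_ne_zero (H.ne_zero z (hsub (Ioo_subset_Icc_self hz))) hz'
  intro x hx y hy he
  rcases lt_trichotomy x y with h | h | h
  · exact (key x hx y hy h he).elim
  · exact h
  · exact (key y hy x hx h he.symm).elim

theorem hasDerivWithinAt_comp (H : IsRegularSemiflow a b F φ) {g g' : ℝ → ℝ}
    (hg : ∀ y ∈ Ioo a b, HasDerivAt g (g' y) y) {x t : ℝ} (hx : x ∈ Ioo a b) (ht : 0 ≤ t) :
    HasDerivWithinAt (fun s => g (φ s x)) (g' (φ t x) * F (φ t x)) (Ici 0) t :=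
  (hg _ (H.mem hx ht)).comp_hasDerivWithinAt t (H.isSemiflowOf.ode x hx t ht)

theorem continuousOn_orbit (H : IsRegularSemiflow a b F φ) {x : ℝ} (hx : x ∈ Ioo a b) :
    ContinuousOn (fun s => φ s x) (Ici 0) := fun t ht =>
  (H.isSemiflowOf.ode x hx t ht).continuousWithinAt

theorem abs_comp_sub_le (H : IsRegularSemiflow a b F φ) {g g' : ℝ → ℝ} {C : ℝ}
    (hg : ∀ y ∈ Ioo a b, HasDerivAt g (g' y) y) (hC : ∀ y ∈ Ioo a b, |g' y * F y| ≤ C)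
    {x t : ℝ} (hx : x ∈ Ioo a b) (ht : 0 ≤ t) : |g (φ t x) - g x| ≤ C * t := by
  have h1 := norm_image_sub_le_of_norm_deriv_right_le_segment (a := 0) (b := t) (C := C)
    (f := fun s => g (φ s x)) (f' := fun s => g' (φ s x) * F (φ s x))
    (fun s hs => ((H.hasDerivWithinAt_comp hg hx hs.1).continuousWithinAt).mono Icc_subset_Ici_self)
    (fun s hs => (H.hasDerivWithinAt_comp hg hx hs.1).mono (Ici_subset_Ici.2 hs.1))
    (fun s hs => hC _ (H.mem hx hs.1)) t (right_mem_Icc.2 ht)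
  simpa [H.isSemiflowOf.init x hx] using h1

/-- Along an orbit travel time has derivative `(F φ)⁻¹ * F φ = 1`. -/
theorem travelTime_flow (H : IsRegularSemiflow a b F φ) {x t : ℝ} (hx : x ∈ Ioo a b)
    (ht : 0 ≤ t) : travelTime a b F (φ t x) = travelTime a b F x + t := by
  have hd : ∀ s, 0 ≤ s → HasDerivWithinAt (fun s => travelTime a b F (φ s x) - s) 0 (Ici 0) s :=
    fun s hs => by
      have := (H.hasDerivWithinAt_comp (fun y hy => H.hasDerivAt_travelTime hy) hx hs).sub
        (hasDerivWithinAt_id s (Ici 0))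
      rwa [inv_mul_cancel₀ (H.ne_zero _ (H.mem hx hs)), sub_self] at this
  have h1 := constant_of_has_deriv_right_zero (a := 0) (b := t)
    (fun s hs => ((hd s hs.1).continuousWithinAt).mono Icc_subset_Ici_self)
    (fun s hs => (hd s hs.1).mono (Ici_subset_Ici.2 hs.1)) t (right_mem_Icc.2 ht)
  rw [H.isSemiflowOf.init x hx] at h1
  linarith

theorem flow_eq (H : IsRegularSemiflow a b F φ) {x y t : ℝ} (hx : x ∈ Ioo a b)
    (hy : y ∈ Ioo a b) (ht : 0 ≤ t) (h : travelTime a b F y = travelTime a b F x + t) :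
    φ t x = y :=
  H.injOn_travelTime (H.mem hx ht) hy (by rw [H.travelTime_flow hx ht, h])

theorem injOn (H : IsRegularSemiflow a b F φ) {t : ℝ} (ht : 0 ≤ t) : InjOn (φ t) (Ioo a b) :=
  fun x hx y hy h => H.injOn_travelTime hx hy (by
    have := congrArg (travelTime a b F) h
    rw [H.travelTime_flow hx ht, H.travelTime_flow hy ht] at this
    linarith)

theorem image_eq (H : IsRegularSemiflow a b F φ) {t : ℝ} (ht : 0 ≤ t) :
    φ t '' Ioo a b =
      Ioo a b ∩ (fun y => travelTime a b F y - t) ⁻¹' (travelTime a b F '' Ioo a b) := by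
  ext y
  constructor
  · rintro ⟨x, hx, rfl⟩
    exact ⟨H.mem hx ht, x, hx, by simp [H.travelTime_flow hx ht]⟩
  · rintro ⟨hy, x, hx, hxy⟩
    exact ⟨x, hx, H.flow_eq hx hy ht (by simp only at hxy; linarith)⟩

theorem image_subset (H : IsRegularSemiflow a b F φ) {t : ℝ} (ht : 0 ≤ t) :
    φ t '' Ioo a b ⊆ Ioo a b := image_subset_iff.2 fun _ hx => H.mem hx ht

theorem image_anti (H : IsRegularSemiflow a b F φ) {s t : ℝ} (hs : 0 ≤ s) (hst : s ≤ t) :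
    φ t '' Ioo a b ⊆ φ s '' Ioo a b := by
  rintro _ ⟨x, hx, rfl⟩
  refine ⟨φ (t - s) x, H.mem hx (by linarith), H.flow_eq (H.mem hx (by linarith))
    (H.mem hx (hs.trans hst)) hs ?_⟩
  rw [H.travelTime_flow hx (hs.trans hst), H.travelTime_flow hx (by linarith)]
  ring

theorem isOpenMap_restrict_travelTime (H : IsRegularSemiflow a b F φ) :
    IsOpenMap ((Ioo a b).domRestrict (travelTime a b F)) := by
  refine IsOpenMap.of_nhds_le fun x => ?_
  have h1 : map (Subtype.val : Ioo a b → ℝ) (𝓝 x) = 𝓝 (x : ℝ) :=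
    isOpen_Ioo.isOpenEmbedding_subtypeVal.map_nhds_eq x
  have h2 := (H.hasStrictDerivAt_travelTime x.2).map_nhds_eq (inv_ne_zero (H.ne_zero _ x.2))
  rw [← h1, map_map] at h2
  exact h2.ge

/-- Travel time as an open partial homeomorphism. -/
noncomputable def chart (H : IsRegularSemiflow a b F φ) : OpenPartialHomeomorph ℝ ℝ :=
  OpenPartialHomeomorph.ofContinuousOpenRestrict (H.injOn_travelTime.toPartialEquiv _ _)
    H.continuousOn_travelTime H.isOpenMap_restrict_travelTime isOpen_Ioo

theorem chart_symm_travelTime (H : IsRegularSemiflow a b F φ) {x : ℝ} (hx : x ∈ Ioo a b) :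
    H.chart.symm (travelTime a b F x) = x := H.chart.left_inv hx

theorem travelTime_mem_target (H : IsRegularSemiflow a b F φ) {x : ℝ} (hx : x ∈ Ioo a b) :
    travelTime a b F x ∈ H.chart.target := H.chart.map_source hx

theorem isOpen_image (H : IsRegularSemiflow a b F φ) {t : ℝ} (ht : 0 ≤ t) :
    IsOpen (φ t '' Ioo a b) := by
  rw [H.image_eq ht]
  exact (H.continuousOn_travelTime.sub continuousOn_const).isOpen_inter_preimage isOpen_Ioo
    H.chart.open_target

/-- Near `x`, `φ t` is the inverse of travel time applied to travel time plus `t`. The derivative `F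
(φ t x) / F x` is written as an exponential so that it is visibly positive and combines with
`sobolevExponent`. -/
theorem hasDerivAt_flow (H : IsRegularSemiflow a b F φ) {x t : ℝ} (hx : x ∈ Ioo a b)
    (ht : 0 ≤ t) : HasDerivAt (φ t) (Real.exp (Real.log (F (φ t x)) - Real.log (F x))) x := by
  rw [← H.div_eq_exp hx (H.mem hx ht)]
  have hy := H.mem hx ht
  have h1 : HasDerivAt H.chart.symm ((F (φ t x))⁻¹)⁻¹ (travelTime a b F (φ t x)) := by
    refine H.chart.hasDerivAt_symm (H.travelTime_mem_target hy) (inv_ne_zero (H.ne_zero _ hy)) ?_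
    rw [H.chart_symm_travelTime hy]
    exact H.hasDerivAt_travelTime hy
  rw [H.travelTime_flow hx ht, inv_inv] at h1
  have h2 := h1.comp x ((H.hasDerivAt_travelTime hx).add_const t)
  rw [div_eq_mul_inv]
  refine h2.congr_of_eventuallyEq ?_
  filter_upwards [isOpen_Ioo.mem_nhds hx] with z hz
  simp only [Function.comp_apply]
  rw [← H.travelTime_flow hz ht, H.chart_symm_travelTime (H.mem hz ht)]

theorem continuousOn_flow (H : IsRegularSemiflow a b F φ) {t : ℝ} (ht : 0 ≤ t) :
    ContinuousOn (φ t) (Ioo a b) := fun _ hx =>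
  (H.hasDerivAt_flow hx ht).continuousAt.continuousWithinAt

theorem backFlow_mem (_H : IsRegularSemiflow a b F φ) {t y : ℝ} (hy : y ∈ φ t '' Ioo a b) :
    backFlow φ (Ioo a b) t y ∈ Ioo a b := Function.invFunOn_mem hy

theorem flow_backFlow (_H : IsRegularSemiflow a b F φ) {t y : ℝ} (hy : y ∈ φ t '' Ioo a b) :
    φ t (backFlow φ (Ioo a b) t y) = y := Function.invFunOn_eq hy

theorem backFlow_flow (H : IsRegularSemiflow a b F φ) {t x : ℝ} (hx : x ∈ Ioo a b)
    (ht : 0 ≤ t) : backFlow φ (Ioo a b) t (φ t x) = x :=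
  H.injOn ht (H.backFlow_mem (mem_image_of_mem _ hx)) hx
    (H.flow_backFlow (mem_image_of_mem _ hx))

theorem travelTime_backFlow (H : IsRegularSemiflow a b F φ) {t y : ℝ} (ht : 0 ≤ t)
    (hy : y ∈ φ t '' Ioo a b) :
    travelTime a b F (backFlow φ (Ioo a b) t y) = travelTime a b F y - t := by
  have := H.travelTime_flow (H.backFlow_mem hy) ht
  rw [H.flow_backFlow hy] at this
  linarith

theorem continuousOn_backFlow (H : IsRegularSemiflow a b F φ) {t : ℝ} (ht : 0 ≤ t) :
    ContinuousOn (backFlow φ (Ioo a b) t) (φ t '' Ioo a b) := by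
  have h1 : ContinuousOn (fun y => H.chart.symm (travelTime a b F y - t)) (φ t '' Ioo a b) :=
    H.chart.continuousOn_symm.comp
      ((H.continuousOn_travelTime.mono (H.image_subset ht)).sub continuousOn_const)
      fun y hy => by
        rw [← H.travelTime_backFlow ht hy]
        exact H.travelTime_mem_target (H.backFlow_mem hy)
  refine h1.congr fun y hy => ?_
  beta_reduce
  rw [← H.travelTime_backFlow ht hy, H.chart_symm_travelTime (H.backFlow_mem hy)]

theorem differentiableOn_backFlow (H : IsRegularSemiflow a b F φ) {t : ℝ} (ht : 0 ≤ t) :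
    DifferentiableOn ℝ (backFlow φ (Ioo a b) t) (φ t '' Ioo a b) := fun y hy => by
  have hJ := (H.isOpen_image ht).mem_nhds hy
  refine (HasDerivAt.of_local_left_inverse ((H.continuousOn_backFlow ht).continuousAt hJ)
    (H.hasDerivAt_flow (H.backFlow_mem hy) ht) (Real.exp_pos _).ne'
    ?_).differentiableAt.differentiableWithinAt
  filter_upwards [hJ] with z hz using H.flow_backFlow hz

/-- The inverse of `φ t` is differentiable, so it maps null sets to null sets. Thus composition with
the flow respects equality a.e. -/
theorem ae_comp_flow (H : IsRegularSemiflow a b F φ) {t : ℝ} (ht : 0 ≤ t) {P : ℝ → Prop}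
    (hP : ∀ᵐ y ∂(volume.restrict (Ioo a b)), P y) :
    ∀ᵐ x ∂(volume.restrict (Ioo a b)), P (φ t x) := by
  rw [ae_restrict_iff' measurableSet_Ioo, ae_iff] at hP ⊢
  have h1 := addHaar_image_eq_zero_of_differentiableOn_of_addHaar_eq_zero volume
    ((H.differentiableOn_backFlow ht).mono inter_subset_left)
    (measure_mono_null (inter_subset_right (s := φ t '' Ioo a b)) hP)
  refine measure_mono_null (fun x hx => ?_) h1
  simp only [mem_ofPred_eq, Classical.not_imp] at hx
  refine ⟨φ t x, ⟨mem_image_of_mem _ hx.1, ?_⟩, H.backFlow_flow hx.1 ht⟩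
  simp only [mem_ofPred_eq, Classical.not_imp]
  exact ⟨H.mem hx.1 ht, hx.2⟩

theorem hasDerivAt_log (H : IsRegularSemiflow a b F φ) {x : ℝ} (hx : x ∈ Ioo a b) :
    HasDerivAt (fun x => Real.log (F x)) (deriv F x / F x) x :=
  (H.hasDerivAt hx).log (H.ne_zero x hx)

/-- Since `F a = 0` and `F'` is bounded, |F(x)| ≤ L (x - a), so log(φ(t,x) - a) changes at rate at
most L. This is what keeps the boundary value 0 at `a` under the semigroup. -/
theorem tendsto_left (H : IsRegularSemiflow a b F φ) {t : ℝ} (ht : 0 ≤ t) :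
    Tendsto (φ t) (𝓝[>] a) (𝓝[>] a) := by
  obtain ⟨L, hL0, hL⟩ := H.exists_deriv_bound
  have hle : ∀ x ∈ Ioo a b, φ t x ≤ a + (x - a) * Real.exp (L * t) := by
    intro x hx
    have hp : 0 < x - a := sub_pos.2 hx.1
    have hy := H.mem hx ht
    have h1 := H.abs_comp_sub_le (g := fun y => Real.log (y - a)) (g' := fun y => 1 / (y - a))
      (C := L) (fun y hy => ((hasDerivAt_id y).sub_const a).log (sub_pos.2 hy.1).ne')
      (fun y hy => by
        have hp := sub_pos.2 hy.1
        rw [abs_mul, abs_of_pos (one_div_pos.2 hp), one_div_mul_eq_div, div_le_iff₀ hp]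
        exact (hL y hy).2) hx ht
    have h2 : Real.log (φ t x - a) ≤ Real.log (x - a) + L * t := by
      linarith [(abs_le.1 h1).2]
    have h3 := Real.exp_le_exp.2 h2
    rw [Real.exp_add, Real.exp_log (sub_pos.2 hy.1), Real.exp_log hp] at h3
    linarith
  refine tendsto_nhdsWithin_iff.2 ⟨?_, ?_⟩
  · refine tendsto_of_tendsto_of_tendsto_of_le_of_le' tendsto_const_nhds ?_ ?_
      ((Ioo_mem_nhdsGT H.lt |> mem_of_superset) hle)
    · have : Continuous fun x => a + (x - a) * Real.exp (L * t) := by fun_prop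
      simpa using (this.tendsto a).mono_left nhdsWithin_le_nhds
    · filter_upwards [Ioo_mem_nhdsGT H.lt] with x hx using (H.mem hx ht).1.le
  · filter_upwards [Ioo_mem_nhdsGT H.lt] with x hx using (H.mem hx ht).1

theorem sobolevExponent_eq (H : IsRegularSemiflow a b F φ) (p : ℝ) (h : ℝ → ℝ) {y z : ℝ}
    (hy : y ∈ Ioo a b) (hz : z ∈ Ioo a b) :
    sobolevExponent a p F h y z = h a * (travelTime a b F z - travelTime a b F y) +
      (1 - 1 / p) * (Real.log (F z) - Real.log (F y)) := by
  have hsub := ordConnected_Ioo.uIcc_subset hy hz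
  have h1 := intervalIntegral.integral_eq_sub_of_hasDerivAt
    (f := fun x => h a * travelTime a b F x + (1 - 1 / p) * Real.log (F x))
    (f' := fun s => (h a - (1 / p - 1) * deriv F s) / F s) (a := y) (b := z)
    (fun x hx => by
      have := ((H.hasDerivAt_travelTime (hsub hx)).const_mul (h a)).add
        ((H.hasDerivAt_log (hsub hx)).const_mul (1 - 1 / p))
      convert! this using 1
      ring)
    (((continuousOn_const.sub (continuousOn_const.mul H.continuousOn_deriv)).div
      H.continuousOn H.ne_zero).mono hsub).intervalIntegrable
  rw [sobolevExponent, h1]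
  ring

theorem sobolevExponent_flow (H : IsRegularSemiflow a b F φ) (p : ℝ) (h : ℝ → ℝ) {x t : ℝ}
    (hx : x ∈ Ioo a b) (ht : 0 ≤ t) :
    sobolevExponent a p F h x (φ t x) = h a * t +
      (1 - 1 / p) * (Real.log (F (φ t x)) - Real.log (F x)) := by
  rw [H.sobolevExponent_eq p h hx (H.mem hx ht), H.travelTime_flow hx ht, add_sub_cancel_left]

theorem sobolevExponent_add (H : IsRegularSemiflow a b F φ) (p : ℝ) (h : ℝ → ℝ) {x y z : ℝ}
    (hx : x ∈ Ioo a b) (hy : y ∈ Ioo a b) (hz : z ∈ Ioo a b) :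
    sobolevExponent a p F h x z = sobolevExponent a p F h x y + sobolevExponent a p F h y z := by
  rw [H.sobolevExponent_eq p h hx hz, H.sobolevExponent_eq p h hx hy,
    H.sobolevExponent_eq p h hy hz]
  ring

/-- The derivative of log|F| along an orbit is `F'` there, which is bounded. The uniform rate `A`
plays the role of a Harnack constant for the weights. -/
theorem exists_abs_sobolevExponent_flow_le (H : IsRegularSemiflow a b F φ) (p : ℝ)
    (h : ℝ → ℝ) : ∃ A, 0 ≤ A ∧ ∀ x ∈ Ioo a b, ∀ t, 0 ≤ t →
      |sobolevExponent a p F h x (φ t x)| ≤ A * t := by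
  obtain ⟨L, hL0, hL⟩ := H.exists_deriv_bound
  refine ⟨|h a| + |1 - 1 / p| * L, by positivity, fun x hx t ht => ?_⟩
  rw [H.sobolevExponent_flow p h hx ht]
  have h1 := H.abs_comp_sub_le (fun y hy => H.hasDerivAt_log hy)
    (fun y hy => by
      rw [div_mul_cancel₀ _ (H.ne_zero y hy)]
      exact (hL y hy).1) hx ht
  refine (abs_add_le _ _).trans ?_
  rw [abs_mul, abs_mul, abs_of_nonneg ht, add_mul, mul_assoc _ L]
  gcongr

theorem continuousOn_sobolevExponent_flow (H : IsRegularSemiflow a b F φ) (p : ℝ) (h : ℝ → ℝ)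
    {t : ℝ} (ht : 0 ≤ t) :
    ContinuousOn (fun x => sobolevExponent a p F h x (φ t x)) (Ioo a b) := by
  have hl : ContinuousOn (fun x => Real.log (F x)) (Ioo a b) := H.continuousOn.log H.ne_zero
  refine ContinuousOn.congr (f := fun x => h a * t +
      (1 - 1 / p) * (Real.log (F (φ t x)) - Real.log (F x))) ?_
    fun x hx => H.sobolevExponent_flow p h hx ht
  exact continuousOn_const.add (continuousOn_const.mul
    ((hl.comp (H.continuousOn_flow ht) fun x hx => H.mem hx ht).sub hl))

end IsRegularSemiflow

/-! ### Sobolev norm, multipliers and a Poincaré inequality -/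

theorem sobolevENorm_congr_ae {Ω : Set ℝ} {p : ENNReal} {u u' : ℝ → ℝ}
    (h : u =ᵐ[volume.restrict Ω] u') : sobolevENorm Ω p u = sobolevENorm Ω p u' := by
  have key : ∀ {u u' : ℝ → ℝ}, u =ᵐ[volume.restrict Ω] u' →
      sobolevENorm Ω p u ≤ sobolevENorm Ω p u' := fun {u u'} h =>
    le_iInf₂ fun v hv => (iInf₂_le v (hv.congr_ae h.symm)).trans (by rw [eLpNorm_congr_ae h])
  exact (key h).antisymm (key h.symm)

theorem IsWeakDeriv.sobolevENorm_le {Ω : Set ℝ} {p : ENNReal} {u v : ℝ → ℝ}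
    (h : IsWeakDeriv Ω u v) :
    sobolevENorm Ω p u ≤ eLpNorm u p (volume.restrict Ω) + eLpNorm v p (volume.restrict Ω) :=
  iInf₂_le v h

theorem IsWeakDeriv.eLpNorm_le_sobolevENorm {a b : ℝ} {p : ENNReal} {u v : ℝ → ℝ}
    (h : IsWeakDeriv (Ioo a b) u v) :
    eLpNorm v p (volume.restrict (Ioo a b)) ≤ sobolevENorm (Ioo a b) p u :=
  le_iInf₂ fun _ hv' => (eLpNorm_congr_ae (h.ae_eq hv')).le.trans le_add_self

theorem eLpNorm_le_sobolevENorm {Ω : Set ℝ} {p : ENNReal} {u : ℝ → ℝ} :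
    eLpNorm u p (volume.restrict Ω) ≤ sobolevENorm Ω p u :=
  le_iInf₂ fun _ _ => le_self_add

theorem IsPrimitiveOn.const_mul {a b : ℝ} {G w : ℝ → ℝ} (h : IsPrimitiveOn a b G w) (c : ℝ) :
    IsPrimitiveOn a b (fun x => c * G x) (fun x => c * w x) :=
  ⟨h.1.smul c, fun x hx y hy => by
    rw [intervalIntegral.integral_const_mul, ← h.2 x hx y hy]; ring⟩

/-- A multiplier of the Sobolev spaces on `(a, b)`: a function that is continuous on `[a, b]` and
`C¹` on `(a, b)`, with bounds for its values and its derivative. -/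
structure IsSobolevMultiplier (a b D : ℝ) (m m' : ℝ → ℝ) : Prop where
  continuousOn : ContinuousOn m (Icc a b)
  hasDerivAt : ∀ x ∈ Ioo a b, HasDerivAt m (m' x) x
  continuousOn_deriv : ContinuousOn m' (Ioo a b)
  abs_le : ∀ x ∈ Ioo a b, |m x| ≤ D
  abs_deriv_le : ∀ x ∈ Ioo a b, |m' x| ≤ D

namespace IsSobolevMultiplier

variable {a b D : ℝ} {m m' : ℝ → ℝ}

theorem isWeakDeriv_mul (hm : IsSobolevMultiplier a b D m m') (hab : a < b) {u v : ℝ → ℝ}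
    (h : IsWeakDeriv (Ioo a b) u v) :
    IsWeakDeriv (Ioo a b) (fun x => m x * u x) (fun x => m' x * u x + m x * v x) := by
  obtain ⟨G, hG, hG'⟩ := h.exists_isPrimitiveOn hab
  have h1 := (hG'.mul (isPrimitiveOn_of_hasDerivAt hm.hasDerivAt hm.continuousOn_deriv)).isWeakDeriv
  have h2 := h1.congr_ae (u' := fun x => m x * u x) (by
    filter_upwards [hG] with x hx
    rw [hx])
  refine ⟨h2.1, ?_, fun ψ h3 h4 h5 => ?_⟩
  · refine LocallyIntegrableOn.add ?_ ?_
    · simpa only [mul_comm] using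
        LocallyIntegrableOn.mul_continuousOn_Ioo h.1 hm.continuousOn_deriv
    · simpa only [mul_comm] using
        LocallyIntegrableOn.mul_continuousOn_Ioo h.2.1 (hm.continuousOn.mono Ioo_subset_Icc_self)
  · rw [h2.2.2 ψ h3 h4 h5]
    congr 1
    refine integral_congr_ae ?_
    filter_upwards [hG] with x hx
    rw [hx]

theorem eLpNorm_mul_le {f g : ℝ → ℝ} (p : ENNReal) (hf : ∀ x ∈ Ioo a b, |f x| ≤ D) :
    eLpNorm (fun x => f x * g x) p (volume.restrict (Ioo a b)) ≤
      ENNReal.ofReal D * eLpNorm g p (volume.restrict (Ioo a b)) := by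
  refine eLpNorm_le_mul_eLpNorm_of_ae_le_mul ?_ p
  filter_upwards [ae_restrict_mem measurableSet_Ioo] with x hx
  rw [norm_mul]
  exact mul_le_mul_of_nonneg_right (hf x hx) (norm_nonneg _)

theorem eLpNorm_deriv_le (hm : IsSobolevMultiplier a b D m m') {p : ENNReal} (hp : 1 ≤ p)
    {u v : ℝ → ℝ} (h : IsWeakDeriv (Ioo a b) u v) :
    eLpNorm (fun x => m' x * u x + m x * v x) p (volume.restrict (Ioo a b)) ≤
      ENNReal.ofReal D * (eLpNorm u p (volume.restrict (Ioo a b)) +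
        eLpNorm v p (volume.restrict (Ioo a b))) := by
  refine (eLpNorm_add_le (f := fun x => m' x * u x) (g := fun x => m x * v x) ?_ ?_ hp).trans ?_
  · exact (hm.continuousOn_deriv.aestronglyMeasurable measurableSet_Ioo).mul
      h.1.aestronglyMeasurable
  · exact ((hm.continuousOn.mono Ioo_subset_Icc_self).aestronglyMeasurable measurableSet_Ioo).mul
      h.2.1.aestronglyMeasurable
  · rw [mul_add]
    exact add_le_add (eLpNorm_mul_le p hm.abs_deriv_le) (eLpNorm_mul_le p hm.abs_le)

theorem sobolevENorm_mul_le (hm : IsSobolevMultiplier a b D m m') (hab : a < b) {p : ENNReal}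
    (hp : 1 ≤ p) (u : ℝ → ℝ) :
    sobolevENorm (Ioo a b) p (fun x => m x * u x) ≤
      2 * ENNReal.ofReal D * sobolevENorm (Ioo a b) p u := by
  by_cases hv : ∃ v, IsWeakDeriv (Ioo a b) u v
  · obtain ⟨v, hv⟩ := hv
    have he : eLpNorm u p (volume.restrict (Ioo a b)) + eLpNorm v p (volume.restrict (Ioo a b)) ≤
        sobolevENorm (Ioo a b) p u :=
      le_iInf₂ fun v' hv' => by rw [eLpNorm_congr_ae (hv.ae_eq hv')]
    refine (hm.isWeakDeriv_mul hab hv).sobolevENorm_le.trans ?_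
    refine (add_le_add (eLpNorm_mul_le p hm.abs_le) (hm.eLpNorm_deriv_le hp hv)).trans ?_
    rw [mul_assoc, two_mul]
    refine add_le_add ?_ ?_
    · exact mul_le_mul_right (le_self_add.trans he) _
    · exact mul_le_mul_right he _
  · have : sobolevENorm (Ioo a b) p u = ⊤ := by
      simp only [sobolevENorm, iInf_eq_top]
      exact fun v hv' => (hv ⟨v, hv'⟩).elim
    -- The norm of `u` is `⊤`, but 0 · ⊤ = 0 in `ENNReal`; so D ≤ 0 is treated apart, where `m`
    -- vanishes on the interval.
    rcases le_or_gt D 0 with h0 | h0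
    · have hz : (fun x => m x * u x) =ᵐ[volume.restrict (Ioo a b)] fun _ => 0 := by
        filter_upwards [ae_restrict_mem measurableSet_Ioo] with x hx
        rw [abs_nonpos_iff.1 ((hm.abs_le x hx).trans h0), zero_mul]
      have hw : IsWeakDeriv (Ioo a b) (fun _ => (0 : ℝ)) (fun _ => 0) :=
        (isPrimitiveOn_of_hasDerivAt (fun x _ => hasDerivAt_const x 0)
          continuousOn_const).isWeakDeriv
      rw [sobolevENorm_congr_ae hz]
      refine hw.sobolevENorm_le.trans ?_
      simp
    · rw [this, ENNReal.mul_top (by simpa using h0)]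
      exact le_top

theorem memSobolev_mul (hm : IsSobolevMultiplier a b D m m') (hab : a < b) {p : ENNReal}
    (hp : 1 ≤ p) {u : ℝ → ℝ} (hu : MemSobolev (Ioo a b) p u) :
    MemSobolev (Ioo a b) p (fun x => m x * u x) := by
  obtain ⟨hu, v, hv, hv'⟩ := hu
  have h1 := hm.isWeakDeriv_mul hab hv
  refine ⟨⟨h1.1.aestronglyMeasurable, ?_⟩, _, h1, h1.2.1.aestronglyMeasurable, ?_⟩
  · exact (eLpNorm_mul_le p hm.abs_le).trans_lt (ENNReal.mul_lt_top ENNReal.ofReal_lt_top hu.2)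
  · exact (hm.eLpNorm_deriv_le hp hv).trans_lt
      (ENNReal.mul_lt_top ENNReal.ofReal_lt_top (ENNReal.add_lt_top.2 ⟨hu.2, hv'.2⟩))

theorem memSobolevStar_mul (hm : IsSobolevMultiplier a b D m m') (hab : a < b) {p : ENNReal}
    (hp : 1 ≤ p) {u : ℝ → ℝ} (hu : MemSobolevStar a b p u) :
    MemSobolevStar a b p (fun x => m x * u x) := by
  refine ⟨hm.memSobolev_mul hab hp hu.1, ?_⟩
  obtain ⟨-, g, hg, hug, hga⟩ := hu
  refine ⟨fun x => m x * g x, hm.continuousOn.mul hg, ?_, by simp [hga]⟩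
  filter_upwards [hug] with x hx
  rw [hx]

end IsSobolevMultiplier

theorem IsPrimitiveOn.enorm_sub_le {a b : ℝ} {G w : ℝ → ℝ} (h : IsPrimitiveOn a b G w)
    {x y : ℝ} (hx : x ∈ Ioo a b) (hy : y ∈ Ioo a b) :
    ‖G y - G x‖ₑ ≤ eLpNorm w 1 (volume.restrict (Ioo a b)) := by
  rw [h.2 x hx y hy, eLpNorm_one_eq_lintegral_enorm, ← ofReal_norm,
    intervalIntegral.norm_intervalIntegral_eq, ofReal_norm]
  refine (enorm_integral_le_lintegral_enorm _).trans (lintegral_mono_set ?_)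
  exact uIoc_subset_uIcc.trans (ordConnected_Ioo.uIcc_subset hx hy)

/-- A Poincaré inequality for functions vanishing at the left end point. -/
theorem IsPrimitiveOn.eLpNorm_le {a b : ℝ} (hab : a < b) {p : ℝ} (hp : 1 ≤ p) {G w : ℝ → ℝ}
    (h : IsPrimitiveOn a b G w) (hG : Tendsto G (𝓝[>] a) (𝓝 0)) :
    eLpNorm G (ENNReal.ofReal p) (volume.restrict (Ioo a b)) ≤
      ENNReal.ofReal (b - a) * eLpNorm w (ENNReal.ofReal p) (volume.restrict (Ioo a b)) := by
  have h1 : ∀ y ∈ Ioo a b, ‖G y‖ₑ ≤ eLpNorm w 1 (volume.restrict (Ioo a b)) := fun y hy => by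
    have h2 : Tendsto (fun x => ‖G y - G x‖ₑ) (𝓝[>] a) (𝓝 ‖G y - 0‖ₑ) :=
      (tendsto_const_nhds.sub hG).enorm
    rw [sub_zero] at h2
    refine le_of_tendsto h2 ?_
    filter_upwards [Ioo_mem_nhdsGT hab] with x hx using h.enorm_sub_le hx hy
  have hp0 : 0 < p := by linarith
  have hq1 : (1 : ENNReal) ≤ ENNReal.ofReal p := by simpa using ENNReal.ofReal_le_ofReal hp
  have hb : 0 < b - a := sub_pos.2 hab
  have h3 := eLpNorm_le_eLpNorm_mul_rpow_measure_univ hq1 h.1.aestronglyMeasurable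
  have h4 : eLpNorm G (ENNReal.ofReal p) (volume.restrict (Ioo a b)) ≤
      eLpNorm w 1 (volume.restrict (Ioo a b)) * ENNReal.ofReal (b - a) ^ (1 / p) := by
    rw [eLpNorm_eq_lintegral_rpow_enorm_toReal (by simpa using hp0) ENNReal.ofReal_ne_top,
      ENNReal.toReal_ofReal hp0.le]
    refine (ENNReal.rpow_le_rpow (setLIntegral_mono' measurableSet_Ioo fun y hy =>
      ENNReal.rpow_le_rpow (h1 y hy) hp0.le) (by positivity)).trans ?_
    rw [setLIntegral_const, Real.volume_Ioo, ENNReal.mul_rpow_of_nonneg _ _ (by positivity),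
      ← ENNReal.rpow_mul, mul_one_div_cancel hp0.ne', ENNReal.rpow_one]
  -- The powers of b - a, 1 - 1/p from Hölder and 1/p from the outer norm, add up to 1.
  refine h4.trans ((mul_le_mul_left h3 _).trans_eq ?_)
  rw [Measure.restrict_apply_univ, Real.volume_Ioo, ENNReal.toReal_ofReal hp0.le, mul_assoc,
    ← ENNReal.rpow_add _ _ (by simpa using hb) ENNReal.ofReal_ne_top, mul_comm]
  simp

/-! ### Reduction to multiplication operators on L^p -/

/-- The weight `exp E(φ(-t, y), y)` for `y ∈ φ(t, (a, b))`, extended by zero. -/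
noncomputable def flowWeight (a b p : ℝ) (F : ℝ → ℝ) (φ : ℝ → ℝ → ℝ) (h : ℝ → ℝ)
    (t : ℝ) : ℝ → ℝ :=
  (φ t '' Ioo a b).indicator fun y =>
    Real.exp (sobolevExponent a p F h (backFlow φ (Ioo a b) t y) y)

/-- The multiplication operators with `flowWeight` tend strongly to zero on `L^p(a, b)`. -/
def FlowWeightDecay (a b p : ℝ) (F : ℝ → ℝ) (φ : ℝ → ℝ → ℝ) (h : ℝ → ℝ) : Prop :=
  ∀ v : ℝ → ℝ, MemLp v (ENNReal.ofReal p) (volume.restrict (Ioo a b)) →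
    Tendsto (fun t => eLpNorm (fun y => flowWeight a b p F φ h t y * v y) (ENNReal.ofReal p)
      (volume.restrict (Ioo a b))) atTop (𝓝 0)

/-- The derivative of `exp (c t) G (φ(t, x))` in terms of the derivative `v` of `G`. -/
noncomputable def pullbackDeriv (F : ℝ → ℝ) (φ : ℝ → ℝ → ℝ) (c t : ℝ) (v : ℝ → ℝ) (x : ℝ) : ℝ :=
  Real.exp (t * c) * (v (φ t x) * Real.exp (Real.log (F (φ t x)) - Real.log (F x)))

theorem weightedComp_const (φ : ℝ → ℝ → ℝ) (c t : ℝ) (u : ℝ → ℝ) (x : ℝ) :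
    weightedComp φ (fun _ => c) t u x = Real.exp (t * c) * u (φ t x) := by
  simp [weightedComp]

theorem MeasureTheory.MemLp.integrableOn_Ioo {a b p : ℝ} (hp : 1 ≤ p) {v : ℝ → ℝ}
    (hv : MemLp v (ENNReal.ofReal p) (volume.restrict (Ioo a b))) : IntegrableOn v (Ioo a b) :=
  hv.integrable (by simpa using ENNReal.ofReal_le_ofReal hp)

theorem IntegrableOn.isPrimitiveOn {a b : ℝ} {v : ℝ → ℝ} (hv : IntegrableOn v (Ioo a b)) :
    IsPrimitiveOn a b (fun x => ∫ s in a..x, v s) v := by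
  refine ⟨hv.locallyIntegrableOn, fun x hx y hy => ?_⟩
  have h1 : ∀ z ∈ Ioo a b, IntervalIntegrable v volume a z := fun z hz => by
    rw [intervalIntegrable_iff_integrableOn_Ioo_of_le hz.1.le]
    exact hv.mono_set (Ioo_subset_Ioo_right hz.2.le)
  rw [intervalIntegral.integral_interval_sub_left (h1 y hy) (h1 x hx)]

theorem IntegrableOn.continuousOn_integral_Icc {a b : ℝ} (hab : a < b) {v : ℝ → ℝ}
    (hv : IntegrableOn v (Ioo a b)) : ContinuousOn (fun x => ∫ s in a..x, v s) (Icc a b) := by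
  have h1 : IntegrableOn v (uIcc a b) := by
    rw [uIcc_of_le hab.le]
    exact (integrableOn_Icc_iff_integrableOn_Ioo (by simp) (by simp)).2 hv
  have := intervalIntegral.continuousOn_primitive_interval h1
  rwa [uIcc_of_le hab.le] at this

theorem memSobolevStar_integral {a b p : ℝ} (hab : a < b) (hp : 1 ≤ p) {v : ℝ → ℝ}
    (hv : MemLp v (ENNReal.ofReal p) (volume.restrict (Ioo a b))) :
    MemSobolevStar a b (ENNReal.ofReal p) fun x => ∫ s in a..x, v s := by
  have hi := hv.integrableOn_Ioo hp
  have hc := IntegrableOn.continuousOn_integral_Icc hab hi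
  obtain ⟨C, hC⟩ := isCompact_Icc.exists_bound_of_continuousOn hc
  refine ⟨⟨MemLp.of_bound ((hc.mono Ioo_subset_Icc_self).aestronglyMeasurable measurableSet_Ioo)
    C ?_, v, (IntegrableOn.isPrimitiveOn hi).isWeakDeriv, hv⟩, _, hc, ae_eq_rfl, by simp⟩
  filter_upwards [ae_restrict_mem measurableSet_Ioo] with x hx using
    hC x (Ioo_subset_Icc_self hx)

theorem memSobolev_const (a b p c : ℝ) :
    MemSobolev (Ioo a b) (ENNReal.ofReal p) fun _ => c :=
  ⟨memLp_const c, fun _ => 0, (isPrimitiveOn_of_hasDerivAt (fun x _ => hasDerivAt_const x c)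
    continuousOn_const).isWeakDeriv, MemLp.zero⟩

namespace IsRegularSemiflow

variable {a b : ℝ} {F : ℝ → ℝ} {φ : ℝ → ℝ → ℝ}

theorem isPrimitiveOn_weightedComp_const (H : IsRegularSemiflow a b F φ) {G v : ℝ → ℝ}
    (hG : IsPrimitiveOn a b G v) (c : ℝ) {t : ℝ} (ht : 0 ≤ t) :
    IsPrimitiveOn a b (weightedComp φ (fun _ => c) t G) (pullbackDeriv F φ c t v) := by
  have h1 := (hG.comp (fun x hx => H.hasDerivAt_flow hx ht) (fun x _ => Real.exp_pos _)
    (H.injOn ht) fun x hx => H.mem hx ht).const_mul (Real.exp (t * c))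
  rwa [funext fun x => weightedComp_const φ c t G x]

theorem flowWeight_flow (H : IsRegularSemiflow a b F φ) (p : ℝ) (h : ℝ → ℝ) {x t : ℝ}
    (hx : x ∈ Ioo a b) (ht : 0 ≤ t) :
    flowWeight a b p F φ h t (φ t x) = Real.exp (sobolevExponent a p F h x (φ t x)) := by
  rw [flowWeight, indicator_of_mem (mem_image_of_mem _ hx), H.backFlow_flow hx ht]

theorem flowWeight_nonneg (p : ℝ) (h : ℝ → ℝ) (t y : ℝ) :
    0 ≤ flowWeight a b p F φ h t y :=
  indicator_nonneg (fun _ _ => (Real.exp_pos _).le) y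

theorem continuousOn_flowWeight (H : IsRegularSemiflow a b F φ) (p : ℝ) (h : ℝ → ℝ) {t : ℝ}
    (ht : 0 ≤ t) : ContinuousOn (flowWeight a b p F φ h t) (φ t '' Ioo a b) := by
  have h1 : ContinuousOn (fun y => Real.exp (sobolevExponent a p F h
      (backFlow φ (Ioo a b) t y) (φ t (backFlow φ (Ioo a b) t y)))) (φ t '' Ioo a b) :=
    Real.continuous_exp.comp_continuousOn ((H.continuousOn_sobolevExponent_flow p h ht).comp
      (H.continuousOn_backFlow ht) fun y hy => H.backFlow_mem hy)
  refine h1.congr fun y hy => ?_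
  simp only
  rw [flowWeight, indicator_of_mem hy, H.flow_backFlow hy]

theorem aestronglyMeasurable_flowWeight (H : IsRegularSemiflow a b F φ) (p : ℝ) (h : ℝ → ℝ)
    {t : ℝ} (ht : 0 ≤ t) : AEStronglyMeasurable (flowWeight a b p F φ h t) volume := by
  have hJ := (H.isOpen_image ht).measurableSet
  refine (aestronglyMeasurable_indicator_iff hJ).2 ?_
  refine ((H.continuousOn_flowWeight p h ht).congr fun y hy => ?_).aestronglyMeasurable hJ
  rw [flowWeight, indicator_of_mem hy]

/-- Substitution y = φ(t,x). The p-th power of the pulled back derivative carries (φ_t')^p; the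
Jacobian accounts for one factor and the remaining (φ_t')^(p-1) is the source of the coefficient 1 -
1/p in the exponent. -/
theorem eLpNorm_pullbackDeriv (H : IsRegularSemiflow a b F φ) {p : ℝ} (hp : 1 ≤ p) (h : ℝ → ℝ)
    (v : ℝ → ℝ) {t : ℝ} (ht : 0 ≤ t) :
    eLpNorm (pullbackDeriv F φ (h a) t v) (ENNReal.ofReal p) (volume.restrict (Ioo a b)) =
      eLpNorm (fun y => flowWeight a b p F φ h t y * v y) (ENNReal.ofReal p)
        (volume.restrict (Ioo a b)) := by
  have hp0 : 0 < p := by linarith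
  have hJ := (H.isOpen_image ht).measurableSet
  rw [eLpNorm_eq_lintegral_rpow_enorm_toReal (by simpa using hp0) ENNReal.ofReal_ne_top,
    eLpNorm_eq_lintegral_rpow_enorm_toReal (by simpa using hp0) ENNReal.ofReal_ne_top,
    ENNReal.toReal_ofReal hp0.le]
  congr 1
  have h1 : (fun y => ‖flowWeight a b p F φ h t y * v y‖ₑ ^ p) =
      (φ t '' Ioo a b).indicator (fun y => ‖flowWeight a b p F φ h t y * v y‖ₑ ^ p) := by
    refine (indicator_eq_self.2 fun y hy => ?_).symm
    by_contra hy'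
    refine hy ?_
    simp [flowWeight, indicator_of_notMem hy', hp0]
  rw [h1, setLIntegral_indicator hJ, inter_eq_left.2 (H.image_subset ht),
    lintegral_image_eq_lintegral_abs_deriv_mul measurableSet_Ioo
      (fun x hx => (H.hasDerivAt_flow hx ht).hasDerivWithinAt) (H.injOn ht)]
  refine setLIntegral_congr_fun measurableSet_Ioo fun x hx => ?_
  rw [H.flowWeight_flow p h hx ht, H.sobolevExponent_flow p h hx ht, pullbackDeriv,
    enorm_mul, enorm_mul, enorm_mul, Real.abs_exp, Real.enorm_of_nonneg (Real.exp_pos _).le,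
    Real.enorm_of_nonneg (Real.exp_pos _).le, Real.enorm_of_nonneg (Real.exp_pos _).le,
    mul_left_comm, mul_comm ‖v (φ t x)‖ₑ, ENNReal.mul_rpow_of_nonneg _ _ hp0.le,
    ENNReal.mul_rpow_of_nonneg _ _ hp0.le, ENNReal.mul_rpow_of_nonneg _ _ hp0.le,
    ENNReal.ofReal_rpow_of_nonneg (Real.exp_pos _).le hp0.le,
    ENNReal.ofReal_rpow_of_nonneg (Real.exp_pos _).le hp0.le,
    ENNReal.ofReal_rpow_of_nonneg (Real.exp_pos _).le hp0.le, ← mul_assoc,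
    ← ENNReal.ofReal_mul (by positivity), ← ENNReal.ofReal_mul (by positivity),
    ← Real.exp_mul, ← Real.exp_mul, ← Real.exp_mul, ← Real.exp_add, ← Real.exp_add]
  congr 3
  field_simp
  ring

/-- Forwards, `v` is tested through its primitive vanishing at `a`. Backwards, the Poincaré
inequality bounds the whole norm by that of the derivative. -/
theorem stableOnSobolevStar_const_iff (H : IsRegularSemiflow a b F φ) {p : ℝ} (hp : 1 ≤ p)
    (h : ℝ → ℝ) :
    StableOnSobolevStar a b (ENNReal.ofReal p) φ (fun _ => h a) ↔
      FlowWeightDecay a b p F φ h := by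
  constructor
  · intro hS v hv
    have h1 := hS _ (memSobolevStar_integral H.lt hp hv)
    refine tendsto_of_tendsto_of_tendsto_of_le_of_le' tendsto_const_nhds h1
      (Eventually.of_forall fun _ => zero_le) ?_
    filter_upwards [eventually_ge_atTop 0] with t ht
    rw [← H.eLpNorm_pullbackDeriv hp h v ht]
    exact (H.isPrimitiveOn_weightedComp_const
      (IntegrableOn.isPrimitiveOn (hv.integrableOn_Ioo hp)) (h a)
      ht).isWeakDeriv.eLpNorm_le_sobolevENorm
  · rintro hW u ⟨⟨-, v, hv, hv'⟩, g, hg, hug, hga⟩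
    obtain ⟨G, huG, hG⟩ := hv.exists_isPrimitiveOn H.lt
    have hGg : EqOn G g (Ioo a b) :=
      Measure.eqOn_open_of_ae_eq (huG.symm.trans hug) isOpen_Ioo hG.continuousOn
        (hg.mono Ioo_subset_Icc_self)
    have hG0 : Tendsto G (𝓝[>] a) (𝓝 0) := by
      have h1 := (hg a (left_mem_Icc.2 H.lt.le)).mono Ioo_subset_Icc_self
      rw [ContinuousWithinAt, hga, nhdsWithin_Ioo_eq_nhdsGT H.lt] at h1
      refine h1.congr' ?_
      filter_upwards [Ioo_mem_nhdsGT H.lt] with x hx using (hGg hx).symm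
    have h1 : Tendsto (fun t => (ENNReal.ofReal (b - a) + 1) *
        eLpNorm (fun y => flowWeight a b p F φ h t y * v y) (ENNReal.ofReal p)
        (volume.restrict (Ioo a b))) atTop (𝓝 0) := by
      simpa using ENNReal.Tendsto.const_mul (hW v hv')
        (Or.inr (ENNReal.add_ne_top.2 ⟨ENNReal.ofReal_ne_top, ENNReal.one_ne_top⟩))
    refine tendsto_of_tendsto_of_tendsto_of_le_of_le' tendsto_const_nhds h1
      (Eventually.of_forall fun _ => zero_le) ?_
    filter_upwards [eventually_ge_atTop 0] with t ht
    have h2 := H.isPrimitiveOn_weightedComp_const hG (h a) ht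
    have h3 : weightedComp φ (fun _ => h a) t u =ᵐ[volume.restrict (Ioo a b)]
        weightedComp φ (fun _ => h a) t G := by
      filter_upwards [H.ae_comp_flow ht huG] with x hx
      rw [weightedComp_const, weightedComp_const, hx]
    have h4 : Tendsto (weightedComp φ (fun _ => h a) t G) (𝓝[>] a) (𝓝 0) := by
      rw [funext fun x => weightedComp_const φ (h a) t G x]
      simpa using (hG0.comp (H.tendsto_left ht)).const_mul (Real.exp (t * h a))
    rw [sobolevENorm_congr_ae h3, ← H.eLpNorm_pullbackDeriv hp h v ht, add_mul, one_mul]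
    exact h2.isWeakDeriv.sobolevENorm_le.trans (add_le_add (h2.eLpNorm_le H.lt hp h4) le_rfl)

end IsRegularSemiflow

/-! ### Auxiliary estimates: essential bounds, exponential multipliers, test functions in L^p -/

theorem ContinuousOn.le_of_ae_le {f : ℝ → ℝ} {U : Set ℝ} (hU : IsOpen U) (hf : ContinuousOn f U)
    {C : ℝ} (h : ∀ᵐ x ∂(volume.restrict U), f x ≤ C) : ∀ x ∈ U, f x ≤ C := by
  have h1 : IsOpen (U ∩ f ⁻¹' Ioi C) := hf.isOpen_inter_preimage hU isOpen_Ioi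
  rw [ae_restrict_iff' hU.measurableSet, ae_iff] at h
  have h2 : U ∩ f ⁻¹' Ioi C = ∅ := by
    refine (h1.measure_eq_zero_iff volume).1 (measure_mono_null (fun x hx => ?_) h)
    simpa using hx
  intro x hx
  by_contra hlt
  exact (h2 ▸ (⟨hx, not_le.1 hlt⟩ : x ∈ U ∩ f ⁻¹' Ioi C) : x ∈ (∅ : Set ℝ))

theorem isSobolevMultiplier_exp {a b C M : ℝ} {K k : ℝ → ℝ} (hK : ContinuousOn K (Icc a b))
    (hd : ∀ x ∈ Ioo a b, HasDerivAt K (k x) x) (hk : ContinuousOn k (Ioo a b))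
    (hC : ∀ x ∈ Icc a b, |K x| ≤ C) (hM : ∀ x ∈ Ioo a b, |k x| ≤ M) (hM0 : 0 ≤ M) :
    IsSobolevMultiplier a b (Real.exp C * (1 + M)) (fun x => Real.exp (K x))
      (fun x => Real.exp (K x) * k x) := by
  have he : ∀ x ∈ Ioo a b, Real.exp (K x) ≤ Real.exp C := fun x hx =>
    Real.exp_le_exp.2 ((le_abs_self _).trans (hC x (Ioo_subset_Icc_self hx)))
  refine ⟨hK.rexp, fun x hx => (hd x hx).exp, ((hK.mono Ioo_subset_Icc_self).rexp).mul hk,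
    fun x hx => ?_, fun x hx => ?_⟩
  · rw [Real.abs_exp]
    nlinarith [he x hx, Real.exp_pos C]
  · rw [abs_mul, Real.abs_exp]
    exact mul_le_mul (he x hx) ((hM x hx).trans (by linarith)) (abs_nonneg _) (Real.exp_pos C).le

/-- Functions in `L^p` that are bounded below on prescribed sets of positive measure. -/
theorem exists_memLp_ge_on {a b p : ℝ} (hp : 1 ≤ p) (U : ℕ → Set ℝ)
    (hU : ∀ n, MeasurableSet (U n)) (hUI : ∀ n, U n ⊆ Ioo a b) (hpos : ∀ n, volume (U n) ≠ 0) :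
    ∃ v : ℝ → ℝ, MemLp v (ENNReal.ofReal p) (volume.restrict (Ioo a b)) ∧
      ∀ n, ∀ᵐ y ∂(volume.restrict (U n)), ((1 / 2) ^ n / volume.real (U n)) ^ (1 / p) ≤ v y := by
  have hp0 : 0 < p := by linarith
  have hfin : ∀ n, volume (U n) ≠ ⊤ := fun n =>
    ((measure_mono (hUI n)).trans_lt measure_Ioo_lt_top).ne
  -- Each indicator is normalized to integral 2⁻ⁿ, so the sum has integral at most 2 even if the
  -- sets overlap; `v` is its p-th root.
  set f : ℝ → ENNReal := fun y => ∑' n, (U n).indicator (fun _ => 2⁻¹ ^ n * (volume (U n))⁻¹) y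
    with hf
  have hfm : Measurable f := Measurable.tsum fun n => measurable_const.indicator (hU n)
  have hfi : ∫⁻ y in Ioo a b, f y ≤ 2 := by
    rw [hf, lintegral_tsum fun n => (measurable_const.indicator (hU n)).aemeasurable]
    refine (ENNReal.tsum_le_tsum fun n => ?_).trans ENNReal.tsum_geometric_two.le
    rw [lintegral_indicator_const (hU n), Measure.restrict_apply (hU n), inter_eq_left.2 (hUI n),
      mul_assoc, ENNReal.inv_mul_cancel (hpos n) (hfin n), mul_one]
  have hft : ∀ᵐ y ∂(volume.restrict (Ioo a b)), f y < ⊤ :=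
    ae_lt_top hfm (hfi.trans_lt (by simp)).ne
  refine ⟨fun y => (f y).toReal ^ (1 / p), ⟨?_, ?_⟩, fun n => ?_⟩
  · exact (hfm.ennreal_toReal.pow_const _).aestronglyMeasurable
  · rw [eLpNorm_lt_top_iff_lintegral_rpow_enorm_lt_top (by simpa using hp0) ENNReal.ofReal_ne_top,
      ENNReal.toReal_ofReal hp0.le]
    refine (lintegral_mono (fun y => ?_)).trans_lt (hfi.trans_lt (by simp))
    rw [Real.enorm_of_nonneg (by positivity), ENNReal.ofReal_rpow_of_nonneg (by positivity) hp0.le,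
      ← Real.rpow_mul ENNReal.toReal_nonneg, one_div_mul_cancel hp0.ne', Real.rpow_one]
    exact ENNReal.ofReal_toReal_le
  · filter_upwards [ae_mono (Measure.restrict_mono (hUI n) le_rfl) hft, ae_restrict_mem (hU n)]
      with y hy hyU
    have h1 : 2⁻¹ ^ n * (volume (U n))⁻¹ ≤ f y := by
      have := ENNReal.le_tsum (f := fun n => (U n).indicator
        (fun _ => 2⁻¹ ^ n * (volume (U n))⁻¹) y) n
      rwa [indicator_of_mem hyU] at this
    have h2 := ENNReal.toReal_mono hy.ne h1
    refine Real.rpow_le_rpow (by positivity) ?_ (by positivity)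
    simpa [div_eq_mul_inv, Measure.real] using h2

theorem enorm_mul_rpow_le_eLpNorm {a b p κ : ℝ} (hp : 1 ≤ p) (hκ : 0 ≤ κ) {U : Set ℝ}
    (hU : volume U ≠ 0) (hUI : U ⊆ Ioo a b) {g : ℝ → ℝ}
    (hg : ∀ᵐ y ∂(volume.restrict U), κ ≤ g y) :
    ENNReal.ofReal κ * volume U ^ (1 / p) ≤
      eLpNorm g (ENNReal.ofReal p) (volume.restrict (Ioo a b)) := by
  have hp0 : 0 < p := by linarith
  have h1 : eLpNorm (fun _ => κ) (ENNReal.ofReal p) (volume.restrict U) =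
      ENNReal.ofReal κ * volume U ^ (1 / p) := by
    rw [eLpNorm_const κ (by simpa using hp0) (by simpa using hU), Measure.restrict_apply_univ,
      ENNReal.toReal_ofReal hp0.le, Real.enorm_of_nonneg hκ]
  rw [← h1]
  refine (eLpNorm_mono_ae ?_).trans (eLpNorm_mono_measure g (Measure.restrict_mono hUI le_rfl))
  filter_upwards [hg] with y hy
  rw [Real.norm_of_nonneg hκ]
  exact hy.trans (le_abs_self _)

/-! ### Conjugation to the constant weight `h a` -/

namespace IsRegularSemiflow

variable {a b : ℝ} {F : ℝ → ℝ} {φ : ℝ → ℝ → ℝ}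

/-- The weight generated by `h` is conjugate to the one generated by the constant `h a`. -/
theorem exists_conjugation (H : IsRegularSemiflow a b F φ) {h : ℝ → ℝ}
    (hcont : ContinuousOn h (Icc a b))
    (hbdd : MemLp (fun y => (h y - h a) / F y) ⊤ (volume.restrict (Ioo a b))) :
    ∃ (D : ℝ) (m m' n n' : ℝ → ℝ), IsSobolevMultiplier a b D m m' ∧
      IsSobolevMultiplier a b D n n' ∧ ∀ x ∈ Ioo a b, ∀ t, 0 ≤ t →
        Real.exp (∫ s in (0 : ℝ)..t, h (φ s x)) =
          n x * (Real.exp (∫ _ in (0 : ℝ)..t, h a) * m (φ t x)) ∧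
        Real.exp (∫ _ in (0 : ℝ)..t, h a) =
          m x * (Real.exp (∫ s in (0 : ℝ)..t, h (φ s x)) * n (φ t x)) := by
  set k : ℝ → ℝ := fun y => (h y - h a) / F y with hk
  have hkc : ContinuousOn k (Ioo a b) :=
    ((hcont.mono Ioo_subset_Icc_self).sub continuousOn_const).div H.continuousOn H.ne_zero
  -- By continuity of `k` the essential bound holds at every point, as a multiplier requires.
  have hM : ∀ x ∈ Ioo a b, |k x| ≤ (eLpNorm k ⊤ (volume.restrict (Ioo a b))).toReal := by
    refine ContinuousOn.le_of_ae_le isOpen_Ioo hkc.abs ?_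
    filter_upwards [ae_le_eLpNormEssSup (f := k) (μ := volume.restrict (Ioo a b))] with x hx
    rw [← Real.norm_eq_abs, ← toReal_enorm]
    exact ENNReal.toReal_mono hbdd.2.ne (by rwa [eLpNorm_exponent_top])
  have hki : IntegrableOn k (Ioo a b) := hbdd.integrable le_top
  set K : ℝ → ℝ := fun x => ∫ s in a..x, k s with hK
  have hKc : ContinuousOn K (Icc a b) := IntegrableOn.continuousOn_integral_Icc H.lt hki
  have hKd : ∀ x ∈ Ioo a b, HasDerivAt K (k x) x := fun x hx =>
    intervalIntegral.integral_hasDerivAt_right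
      ((intervalIntegrable_iff_integrableOn_Ioo_of_le hx.1.le).2
        (hki.mono_set (Ioo_subset_Ioo_right hx.2.le)))
      (hkc.stronglyMeasurableAtFilter isOpen_Ioo x hx) (hkc.continuousAt (isOpen_Ioo.mem_nhds hx))
  obtain ⟨C, hC⟩ := isCompact_Icc.exists_bound_of_continuousOn hKc
  -- Along an orbit K(φ) has derivative k(φ) F(φ) = h(φ) - h(a).
  have hint : ∀ x ∈ Ioo a b, ∀ t, 0 ≤ t →
      ∫ s in (0 : ℝ)..t, h (φ s x) = t * h a + (K (φ t x) - K x) := by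
    intro x hx t ht
    have hd : ∀ s, 0 ≤ s → HasDerivWithinAt (fun s => K (φ s x) + s * h a) (h (φ s x)) (Ici 0) s :=
      fun s hs => by
        have := (H.hasDerivWithinAt_comp hKd hx hs).add
          ((hasDerivWithinAt_id s (Ici 0)).mul_const (h a))
        convert! this using 1
        simp only [hk]
        rw [div_mul_cancel₀ _ (H.ne_zero _ (H.mem hx hs))]
        ring
    have hu : uIcc 0 t ⊆ Ici 0 := by
      rw [uIcc_of_le ht]
      exact Icc_subset_Ici_self
    have h1 := intervalIntegral.integral_eq_sub_of_hasDeriv_right (a := 0) (b := t)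
      (f := fun s => K (φ s x) + s * h a) (f' := fun s => h (φ s x))
      (fun s hs => (hd s (hu hs)).continuousWithinAt.mono hu)
      (fun s hs => by
        rw [min_eq_left ht] at hs
        exact (hd s hs.1.le).mono (Ioi_subset_Ici hs.1.le))
      ((hcont.comp ((H.continuousOn_orbit hx).mono hu) fun s hs =>
        Ioo_subset_Icc_self (H.mem hx (hu hs))).intervalIntegrable)
    rw [h1, H.isSemiflowOf.init x hx]
    ring
  have hmul := isSobolevMultiplier_exp hKc hKd hkc hC hM ENNReal.toReal_nonneg
  have hmul' := isSobolevMultiplier_exp (K := fun x => -K x) (k := fun x => -k x) hKc.neg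
    (fun x hx => (hKd x hx).neg) hkc.neg (fun x hx => by simpa using hC x hx)
    (fun x hx => by simpa using hM x hx) ENNReal.toReal_nonneg
  refine ⟨_, _, _, _, _, hmul, hmul', fun x hx t ht => ?_⟩
  rw [hint x hx t ht, intervalIntegral.integral_const, sub_zero, smul_eq_mul, ← Real.exp_add,
    ← Real.exp_add, ← Real.exp_add, ← Real.exp_add]
  exact ⟨congrArg _ (by ring), congrArg _ (by ring)⟩

end IsRegularSemiflow

/-- Decay of a weighted composition semigroup passes to a conjugate one. -/
theorem tendsto_sobolevENorm_weightedComp_of_conjugate {a b D : ℝ} (hab : a < b) {p : ENNReal}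
    (hp : 1 ≤ p) {φ : ℝ → ℝ → ℝ} {h h' m n n' : ℝ → ℝ} (hn : IsSobolevMultiplier a b D n n')
    (hmn : ∀ x ∈ Ioo a b, ∀ t, 0 ≤ t → Real.exp (∫ s in (0 : ℝ)..t, h (φ s x)) =
      n x * (Real.exp (∫ s in (0 : ℝ)..t, h' (φ s x)) * m (φ t x))) {u : ℝ → ℝ}
    (hu : Tendsto (fun t => sobolevENorm (Ioo a b) p (weightedComp φ h' t fun y => m y * u y))
      atTop (𝓝 0)) :
    Tendsto (fun t => sobolevENorm (Ioo a b) p (weightedComp φ h t u)) atTop (𝓝 0) := by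
  have h1 := ENNReal.Tendsto.const_mul hu (a := 2 * ENNReal.ofReal D)
    (Or.inr (ENNReal.mul_ne_top (by simp) ENNReal.ofReal_ne_top))
  rw [mul_zero] at h1
  refine tendsto_of_tendsto_of_tendsto_of_le_of_le' tendsto_const_nhds h1
    (Eventually.of_forall fun _ => zero_le) ?_
  filter_upwards [eventually_ge_atTop 0] with t ht
  have h2 : weightedComp φ h t u =ᵐ[volume.restrict (Ioo a b)]
      fun x => n x * weightedComp φ h' t (fun y => m y * u y) x := by
    filter_upwards [ae_restrict_mem measurableSet_Ioo] with x hx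
    rw [weightedComp, weightedComp, hmn x hx t ht]
    ring
  rw [sobolevENorm_congr_ae h2]
  exact hn.sobolevENorm_mul_le hab hp _

namespace IsRegularSemiflow

variable {a b : ℝ} {F : ℝ → ℝ} {φ : ℝ → ℝ → ℝ}

theorem stable_iff_stable_const (H : IsRegularSemiflow a b F φ) {p : ENNReal} (hp : 1 ≤ p)
    {h : ℝ → ℝ} (hcont : ContinuousOn h (Icc a b))
    (hbdd : MemLp (fun y => (h y - h a) / F y) ⊤ (volume.restrict (Ioo a b))) :
    (StableOnSobolev a b p φ h ↔ StableOnSobolev a b p φ fun _ => h a) ∧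
      (StableOnSobolevStar a b p φ h ↔ StableOnSobolevStar a b p φ fun _ => h a) := by
  obtain ⟨D, m, m', n, n', hm, hn, hmn⟩ := H.exists_conjugation hcont hbdd
  refine ⟨⟨fun hS u hu => ?_, fun hS u hu => ?_⟩, ⟨fun hS u hu => ?_, fun hS u hu => ?_⟩⟩
  · exact tendsto_sobolevENorm_weightedComp_of_conjugate H.lt hp hm
      (fun x hx t ht => (hmn x hx t ht).2) (hS _ (hn.memSobolev_mul H.lt hp hu))
  · exact tendsto_sobolevENorm_weightedComp_of_conjugate H.lt hp hn
      (fun x hx t ht => (hmn x hx t ht).1) (hS _ (hm.memSobolev_mul H.lt hp hu))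
  · exact tendsto_sobolevENorm_weightedComp_of_conjugate H.lt hp hm
      (fun x hx t ht => (hmn x hx t ht).2) (hS _ (hn.memSobolevStar_mul H.lt hp hu))
  · exact tendsto_sobolevENorm_weightedComp_of_conjugate H.lt hp hn
      (fun x hx t ht => (hmn x hx t ht).1) (hS _ (hm.memSobolevStar_mul H.lt hp hu))

end IsRegularSemiflow

/-! ### Strong decay of the weights: sufficiency and necessity -/

namespace IsRegularSemiflow

variable {a b : ℝ} {F : ℝ → ℝ} {φ : ℝ → ℝ → ℝ}

theorem forall_sobolevExponent_le_of_ae (H : IsRegularSemiflow a b F φ) {p C : ℝ} {h : ℝ → ℝ}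
    (hC : ∀ᵐ y ∂(volume.restrict (Ioo a b)), ∀ t : ℝ, 0 ≤ t →
      sobolevExponent a p F h y (φ t y) ≤ C) :
    ∀ y ∈ Ioo a b, ∀ t, 0 ≤ t → sobolevExponent a p F h y (φ t y) ≤ C := fun y hy t ht =>
  ContinuousOn.le_of_ae_le isOpen_Ioo (H.continuousOn_sobolevExponent_flow p h ht)
    (hC.mono fun _ hx => hx t ht) y hy

/-- Dominated convergence with majorant |exp(C) v|^p. -/
theorem flowWeightDecay_of_bound (H : IsRegularSemiflow a b F φ) {p C : ℝ} (hp : 1 ≤ p)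
    {h : ℝ → ℝ} (hC : ∀ y ∈ Ioo a b, ∀ t, 0 ≤ t → sobolevExponent a p F h y (φ t y) ≤ C)
    (h0 : ∀ y ∈ Ioo a b, Tendsto (fun t => flowWeight a b p F φ h t y) atTop (𝓝 0)) :
    FlowWeightDecay a b p F φ h := by
  intro v hv
  have hp0 : 0 < p := by linarith
  have hle : ∀ t, 0 ≤ t → ∀ y, flowWeight a b p F φ h t y ≤ Real.exp C := fun t ht y => by
    by_cases hy : y ∈ φ t '' Ioo a b
    · obtain ⟨x, hx, rfl⟩ := hy
      rw [H.flowWeight_flow p h hx ht]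
      exact Real.exp_le_exp.2 (hC x hx t ht)
    · rw [flowWeight, indicator_of_notMem hy]
      exact (Real.exp_pos C).le
  have hq : ENNReal.ofReal p ≠ 0 := by simpa using hp0
  have key : Tendsto (fun t => ∫⁻ y in Ioo a b, ‖flowWeight a b p F φ h t y * v y‖ₑ ^ p)
      atTop (𝓝 (∫⁻ _ in Ioo a b, 0)) := by
    refine tendsto_lintegral_filter_of_dominated_convergence'
      (fun y => ‖Real.exp C * v y‖ₑ ^ p) ?_ ?_ ?_ ?_
    · filter_upwards [eventually_ge_atTop 0] with t ht
      exact ((H.aestronglyMeasurable_flowWeight p h ht).restrict.mul hv.1).enorm.pow_const p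
    · filter_upwards [eventually_ge_atTop 0] with t ht
      refine ae_of_all _ fun y => ENNReal.rpow_le_rpow ?_ hp0.le
      rw [enorm_mul, enorm_mul, Real.enorm_of_nonneg (flowWeight_nonneg p h t y),
        Real.enorm_of_nonneg (Real.exp_pos C).le]
      exact mul_le_mul_left (ENNReal.ofReal_le_ofReal (hle t ht y)) _
    · have h1 := (hv.const_mul (Real.exp C)).2
      rw [eLpNorm_lt_top_iff_lintegral_rpow_enorm_lt_top hq ENNReal.ofReal_ne_top,
        ENNReal.toReal_ofReal hp0.le] at h1
      exact h1.ne
    · filter_upwards [ae_restrict_mem measurableSet_Ioo] with y hy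
      have h1 := ((h0 y hy).mul_const (v y)).enorm
      rw [zero_mul, enorm_zero] at h1
      have h2 := ((ENNReal.continuous_rpow_const (y := p)).tendsto 0).comp h1
      rwa [ENNReal.zero_rpow_of_pos hp0] at h2
  rw [lintegral_zero] at key
  have h2 := ((ENNReal.continuous_rpow_const (y := 1 / p)).tendsto 0).comp key
  rw [ENNReal.zero_rpow_of_pos (by positivity)] at h2
  refine h2.congr fun t => ?_
  rw [eLpNorm_eq_lintegral_rpow_enorm_toReal hq ENNReal.ofReal_ne_top,
    ENNReal.toReal_ofReal hp0.le]
  rfl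

/-- A gliding hump argument: strong decay of the weights implies that they are bounded. -/
theorem exists_bound_of_flowWeightDecay (H : IsRegularSemiflow a b F φ) {p : ℝ} (hp : 1 ≤ p)
    {h : ℝ → ℝ} (hW : FlowWeightDecay a b p F φ h) :
    ∃ C, ∀ y ∈ Ioo a b, ∀ t, 0 ≤ t → sobolevExponent a p F h y (φ t y) ≤ C := by
  by_contra! hcon
  have hp0 : 0 < p := by linarith
  obtain ⟨A, hA0, hA⟩ := H.exists_abs_sobolevExponent_flow_le p h
  choose x hx t ht hxt using fun n : ℕ => hcon n
  -- The exponent grows at most at rate `A` in time, so exceeding `n` needs a time of at least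
  -- n/(A+1).
  have htt : Tendsto t atTop atTop := by
    have h1 : Tendsto (fun n : ℕ => (n : ℝ) / (A + 1)) atTop atTop :=
      tendsto_natCast_atTop_atTop.atTop_div_const (by linarith)
    refine tendsto_atTop_mono (fun n => ?_) h1
    rw [div_le_iff₀ (by linarith)]
    have := (abs_le.1 (hA (x n) (hx n) (t n) (ht n))).2
    nlinarith [hxt n, ht n]
  set U : ℕ → Set ℝ := fun n =>
    φ (t n) '' Ioo a b ∩ flowWeight a b p F φ h (t n) ⁻¹' Ioi (Real.exp n) with hU
  have hUo : ∀ n, IsOpen (U n) := fun n =>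
    (H.continuousOn_flowWeight p h (ht n)).isOpen_inter_preimage (H.isOpen_image (ht n)) isOpen_Ioi
  have hUI : ∀ n, U n ⊆ Ioo a b := fun n => inter_subset_left.trans (H.image_subset (ht n))
  have hUpos : ∀ n, volume (U n) ≠ 0 := fun n => by
    refine ((hUo n).measure_pos volume ⟨φ (t n) (x n), mem_image_of_mem _ (hx n), ?_⟩).ne'
    rw [mem_preimage, H.flowWeight_flow p h (hx n) (ht n)]
    exact Real.exp_lt_exp.2 (hxt n)
  obtain ⟨v, hv, hvU⟩ := exists_memLp_ge_on hp U (fun n => (hUo n).measurableSet) hUI hUpos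
  -- On `U n` the weight exceeds eⁿ, while `v` contributes norm at least 2^(-n/p) ≥ 2⁻ⁿ there; the
  -- product stays at least 1, contradicting decay along `t n`.
  have h1 : ∀ n, 1 ≤ eLpNorm (fun y => flowWeight a b p F φ h (t n) y * v y) (ENNReal.ofReal p)
      (volume.restrict (Ioo a b)) := fun n => by
    have hfin : volume (U n) ≠ ⊤ := ((measure_mono (hUI n)).trans_lt measure_Ioo_lt_top).ne
    have hr : 0 < volume.real (U n) := ENNReal.toReal_pos (hUpos n) hfin
    refine le_trans ?_ (enorm_mul_rpow_le_eLpNorm hp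
      (κ := Real.exp n * ((1 / 2) ^ n / volume.real (U n)) ^ (1 / p)) (by positivity) (hUpos n)
      (hUI n) ?_)
    · rw [← ENNReal.ofReal_toReal hfin, ← Measure.real, ENNReal.ofReal_rpow_of_nonneg hr.le (by positivity),
        ← ENNReal.ofReal_mul (by positivity), ENNReal.one_le_ofReal, mul_assoc,
        ← Real.mul_rpow (by positivity) hr.le, div_mul_cancel₀ _ hr.ne']
      have h2 : ((1 : ℝ) / 2) ^ n ≤ ((1 / 2) ^ n) ^ (1 / p) := by
        have := Real.rpow_le_rpow_of_exponent_ge (x := ((1 : ℝ) / 2) ^ n) (y := 1) (z := 1 / p)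
          (by positivity) (pow_le_one₀ (by norm_num) (by norm_num)) ((div_le_one hp0).2 hp)
        rwa [Real.rpow_one] at this
      have h3 : (2 : ℝ) ^ n ≤ Real.exp n := by
        rw [← mul_one (n : ℝ), Real.exp_nat_mul]
        exact pow_le_pow_left₀ (by norm_num) (by linarith [Real.add_one_le_exp (1 : ℝ)]) n
      calc (1 : ℝ) = 2 ^ n * (1 / 2) ^ n := by rw [← mul_pow]; norm_num
        _ ≤ _ := mul_le_mul h3 h2 (by positivity) (Real.exp_pos _).le
    · filter_upwards [hvU n, ae_restrict_mem (hUo n).measurableSet] with y hy hyU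
      exact mul_le_mul (le_of_lt hyU.2) hy (by positivity) (flowWeight_nonneg p h _ y)
  have h2 := ge_of_tendsto ((hW v hv).comp htt) (Eventually.of_forall h1)
  simp at h2

theorem tendsto_flowWeight_of_not_mem (H : IsRegularSemiflow a b F φ) (p : ℝ) (h : ℝ → ℝ)
    {y t₀ : ℝ} (ht₀ : 0 ≤ t₀) (hy : y ∉ φ t₀ '' Ioo a b) :
    Tendsto (fun t => flowWeight a b p F φ h t y) atTop (𝓝 0) := by
  refine tendsto_const_nhds.congr' ?_
  filter_upwards [eventually_ge_atTop t₀] with t ht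
  rw [flowWeight, indicator_of_notMem fun hy' => hy (H.image_anti ht₀ ht hy')]

theorem tendsto_flowWeight_iff {p : ℝ} {h : ℝ → ℝ}
    (hsurj : ∀ t : ℝ, 0 < t → φ t '' Ioo a b = Ioo a b) {y : ℝ} (hy : y ∈ Ioo a b) :
    Tendsto (fun t => flowWeight a b p F φ h t y) atTop (𝓝 0) ↔
      Tendsto (fun t : ℝ => sobolevExponent a p F h (backFlow φ (Ioo a b) t y) y) atTop atBot := by
  rw [← Real.tendsto_exp_comp_nhds_zero]
  refine tendsto_congr' ?_
  filter_upwards [eventually_gt_atTop 0] with t ht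
  rw [flowWeight, indicator_of_mem (by rwa [hsurj t ht])]

/-- Norm decay for v = 1 gives decay at a point because the weight at `y` is bounded, up to a factor
independent of `t`, by the weight on an open set. -/
theorem tendsto_flowWeight_of_flowWeightDecay (H : IsRegularSemiflow a b F φ) {p : ℝ}
    (hp : 1 ≤ p) {h : ℝ → ℝ} (hW : FlowWeightDecay a b p F φ h)
    (hsurj : ∀ t : ℝ, 0 < t → φ t '' Ioo a b = Ioo a b) {y : ℝ} (hy : y ∈ Ioo a b) :
    Tendsto (fun t => flowWeight a b p F φ h t y) atTop (𝓝 0) := by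
  have hp0 : 0 < p := by linarith
  obtain ⟨A, hA0, hA⟩ := H.exists_abs_sobolevExponent_flow_le p h
  -- The points that the flow reaches from `y` in a time between 0 and 1.
  set U : Set ℝ := Ioo a b ∩ travelTime a b F ⁻¹'
    Ioo (travelTime a b F y) (travelTime a b F y + 1) with hU
  have hUo : IsOpen U := H.continuousOn_travelTime.isOpen_inter_preimage isOpen_Ioo isOpen_Ioo
  have hUpos : volume U ≠ 0 := by
    refine (hUo.measure_pos volume ⟨φ (1 / 2) y, H.mem hy (by norm_num), ?_⟩).ne'
    rw [mem_preimage, H.travelTime_flow hy (by norm_num)]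
    exact ⟨by linarith, by linarith⟩
  have hfin : volume U ≠ ⊤ :=
    ((measure_mono inter_subset_left).trans_lt (measure_Ioo_lt_top (a := a) (b := b))).ne
  have hlow : ∀ t, 0 < t → ∀ z ∈ U,
      flowWeight a b p F φ h t y * Real.exp (-(2 * A)) ≤ flowWeight a b p F φ h t z := by
    rintro t ht z ⟨hz, hz1, hz2⟩
    have hyJ : y ∈ φ t '' Ioo a b := by rwa [hsurj t ht]
    have hzJ : z ∈ φ t '' Ioo a b := by rwa [hsurj t ht]
    have hs : 0 ≤ travelTime a b F z - travelTime a b F y := by linarith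
    have hby := H.backFlow_mem hyJ
    have hbz := H.backFlow_mem hzJ
    have e1 : φ (travelTime a b F z - travelTime a b F y) y = z :=
      H.flow_eq hy hz hs (by ring)
    have e2 : φ (travelTime a b F z - travelTime a b F y) (backFlow φ (Ioo a b) t y) =
        backFlow φ (Ioo a b) t z :=
      H.flow_eq hby hbz hs (by
        rw [H.travelTime_backFlow ht.le hzJ, H.travelTime_backFlow ht.le hyJ]; ring)
    have b1 := hA y hy _ hs
    -- The same time shift takes `y` to `z` and φ(-t,y) to φ(-t,z). Each of the two shifts changes
    -- the exponent by at most `A`, whence the factor exp(-2A).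
    have b2 := hA _ hby _ hs
    rw [e1] at b1
    rw [e2] at b2
    have s1 := H.sobolevExponent_add p h hby hbz hz
    have s2 := H.sobolevExponent_add p h hby hy hz
    rw [flowWeight, indicator_of_mem hyJ, indicator_of_mem hzJ, ← Real.exp_add]
    refine Real.exp_le_exp.2 ?_
    have hs1 : A * (travelTime a b F z - travelTime a b F y) ≤ A :=
      mul_le_of_le_one_right hA0 (by linarith)
    linarith [(abs_le.1 b1).1, (abs_le.1 b2).2]
  set κ : ENNReal := ENNReal.ofReal (Real.exp (-(2 * A))) * volume U ^ (1 / p) with hκ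
  have hκ0 : κ ≠ 0 := mul_ne_zero (by simpa using Real.exp_pos _)
    (by simp [ENNReal.rpow_eq_zero_iff, hUpos, hfin])
  have hκt : κ ≠ ⊤ := ENNReal.mul_ne_top ENNReal.ofReal_ne_top
    (ENNReal.rpow_ne_top_of_nonneg (by positivity) hfin)
  have h1 := hW (fun _ => 1) (memLp_const 1)
  simp only [mul_one] at h1
  have h2 : Tendsto (fun t => ENNReal.ofReal (flowWeight a b p F φ h t y) * κ) atTop (𝓝 0) := by
    refine tendsto_of_tendsto_of_tendsto_of_le_of_le' tendsto_const_nhds h1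
      (Eventually.of_forall fun _ => zero_le) ?_
    filter_upwards [eventually_gt_atTop 0] with t ht
    have h3 := enorm_mul_rpow_le_eLpNorm hp
      (mul_nonneg (flowWeight_nonneg (F := F) (φ := φ) p h t y) (Real.exp_pos (-(2 * A))).le) hUpos
      inter_subset_left ((ae_restrict_mem hUo.measurableSet).mono (hlow t ht))
    rwa [ENNReal.ofReal_mul (flowWeight_nonneg p h t y), mul_assoc] at h3
  have h3 := ENNReal.Tendsto.mul_const h2 (b := κ⁻¹) (Or.inr (ENNReal.inv_ne_top.2 hκ0))
  simp only [mul_assoc, ENNReal.mul_inv_cancel hκ0 hκt, mul_one, zero_mul] at h3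
  have h4 := (ENNReal.tendsto_toReal ENNReal.zero_ne_top).comp h3
  refine h4.congr fun t => ?_
  simp [flowWeight_nonneg]

/-- As log|F| is bounded above and 1 - 1/p ≥ 0, the backward exponent is at least h(a)t minus a
constant, which forces h(a)t → -∞; the forward exponent is at most h(a)t plus a constant. -/
theorem tendsto_sobolevExponent_flow (H : IsRegularSemiflow a b F φ) {p : ℝ} (hp : 1 ≤ p)
    {h : ℝ → ℝ} (hsurj : ∀ t : ℝ, 0 < t → φ t '' Ioo a b = Ioo a b) {y : ℝ} (hy : y ∈ Ioo a b)
    (hlim : Tendsto (fun t : ℝ => sobolevExponent a p F h (backFlow φ (Ioo a b) t y) y)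
      atTop atBot) :
    Tendsto (fun t : ℝ => sobolevExponent a p F h y (φ t y)) atTop atBot := by
  obtain ⟨B, hB⟩ := H.exists_log_le
  have hp' : 0 ≤ 1 - 1 / p := sub_nonneg.2 ((div_le_one (by linarith)).2 hp)
  have h1 : Tendsto (fun t : ℝ => h a * t) atTop atBot := by
    refine tendsto_atBot_mono' _ ?_
      (tendsto_atBot_add_const_right _ ((1 - 1 / p) * (B - Real.log (F y))) hlim)
    filter_upwards [eventually_gt_atTop 0] with t ht
    have hyJ : y ∈ φ t '' Ioo a b := by rwa [hsurj t ht]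
    rw [H.sobolevExponent_eq p h (H.backFlow_mem hyJ) hy, H.travelTime_backFlow ht.le hyJ]
    nlinarith [hB _ (H.backFlow_mem hyJ)]
  refine tendsto_atBot_mono' _ ?_
    (tendsto_atBot_add_const_right _ ((1 - 1 / p) * (B - Real.log (F y))) h1)
  filter_upwards [eventually_ge_atTop 0] with t ht
  rw [H.sobolevExponent_flow p h hy ht]
  nlinarith [hB _ (H.mem hy ht)]

/-! ### From W^{1,p}_* to W^{1,p}: the constants -/

theorem stableOnSobolev_const_iff (H : IsRegularSemiflow a b F φ) {p : ℝ} (hp : 1 ≤ p) (c : ℝ) :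
    StableOnSobolev a b (ENNReal.ofReal p) φ (fun _ => c) ↔
      StableOnSobolevStar a b (ENNReal.ofReal p) φ (fun _ => c) ∧ c < 0 := by
  have hp0 : 0 < p := by linarith
  have hq1 : (1 : ENNReal) ≤ ENNReal.ofReal p := by simpa using ENNReal.ofReal_le_ofReal hp
  have hvol : volume.restrict (Ioo a b) ≠ 0 := by
    simp [Measure.restrict_eq_zero, Real.volume_Ioo, H.lt]
  have hc1 : ∀ d t, weightedComp φ (fun _ => c) t (fun _ => d) =
      fun _ : ℝ => Real.exp (t * c) * d := fun d t => funext fun x => weightedComp_const φ c t _ x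
  have hexp : c < 0 ↔ Tendsto (fun t : ℝ => Real.exp (t * c)) atTop (𝓝 0) := by
    rw [Real.tendsto_exp_comp_nhds_zero]
    constructor
    · exact fun hc => tendsto_id.atTop_mul_const_of_neg hc
    · intro ht
      obtain ⟨t, ht1, ht2⟩ := ((ht.eventually_lt_atBot 0).and (eventually_gt_atTop 0)).exists
      by_contra! hc
      nlinarith
  have hnorm : ∀ d : ℝ, eLpNorm (fun _ : ℝ => d) (ENNReal.ofReal p) (volume.restrict (Ioo a b)) =
      ‖d‖ₑ * ENNReal.ofReal (b - a) ^ (1 / p) := fun d => by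
    rw [eLpNorm_const d (by simpa using hp0) hvol, Measure.restrict_apply_univ, Real.volume_Ioo,
      ENNReal.toReal_ofReal hp0.le]
  set κ : ENNReal := ENNReal.ofReal (b - a) ^ (1 / p) with hκ
  have hκ0 : κ ≠ 0 := by
    simp [hκ, ENNReal.rpow_eq_zero_iff, H.lt]
  have hκt : κ ≠ ⊤ := ENNReal.rpow_ne_top_of_nonneg (by positivity) ENNReal.ofReal_ne_top
  constructor
  · refine fun hS => ⟨fun u hu => hS u hu.1, hexp.2 ?_⟩
    have h1 := hS _ (memSobolev_const a b p 1)
    simp only [hc1, mul_one] at h1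
    have h2 : Tendsto (fun t : ℝ => ‖Real.exp (t * c)‖ₑ * κ) atTop (𝓝 0) :=
      tendsto_of_tendsto_of_tendsto_of_le_of_le tendsto_const_nhds h1 (fun _ => zero_le)
        fun t => (hnorm _).ge.trans eLpNorm_le_sobolevENorm
    have h3 := ENNReal.Tendsto.mul_const h2 (b := κ⁻¹) (Or.inr (ENNReal.inv_ne_top.2 hκ0))
    simp only [mul_assoc, ENNReal.mul_inv_cancel hκ0 hκt, mul_one, zero_mul] at h3
    have h4 := (ENNReal.tendsto_toReal ENNReal.zero_ne_top).comp h3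
    refine h4.congr fun t => ?_
    simp
  · rintro ⟨hS, hc⟩ u ⟨hu, v, hv, hv'⟩
    obtain ⟨G, huG, hG⟩ := hv.exists_isPrimitiveOn H.lt
    have hG1 := IntegrableOn.isPrimitiveOn (hv'.integrableOn_Ioo hp)
    -- Splits `u` into a function vanishing at `a` and the constant `d`; the semigroup sends the
    -- latter to exp(tc) d, whose derivative is zero.
    obtain ⟨d, hd⟩ : ∃ d, ∀ x ∈ Ioo a b, G x = (∫ s in a..x, v s) + d :=
      ⟨G ((a + b) / 2) - ∫ s in a..(a + b) / 2, v s, fun x hx => by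
        have e1 := hG.2 _ H.mid_mem x hx
        have e2 := hG1.2 _ H.mid_mem x hx
        linarith⟩
    have h1 := hS _ (memSobolevStar_integral H.lt hp hv')
    have h2 : Tendsto (fun t : ℝ => ‖Real.exp (t * c) * d‖ₑ * κ) atTop (𝓝 0) := by
      have h3 := ENNReal.Tendsto.mul_const (((hexp.1 hc).mul_const d).enorm) (b := κ)
        (Or.inr hκt)
      simpa using h3
    have h3 := h1.add h2
    rw [add_zero] at h3
    refine tendsto_of_tendsto_of_tendsto_of_le_of_le' tendsto_const_nhds h3
      (Eventually.of_forall fun _ => zero_le) ?_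
    filter_upwards [eventually_ge_atTop 0] with t ht
    have h4 : weightedComp φ (fun _ => c) t u =ᵐ[volume.restrict (Ioo a b)] fun x =>
        weightedComp φ (fun _ => c) t (fun x => ∫ s in a..x, v s) x + Real.exp (t * c) * d := by
      filter_upwards [H.ae_comp_flow ht huG, ae_restrict_mem measurableSet_Ioo] with x hx hxI
      rw [weightedComp_const, weightedComp_const, hx, hd _ (H.mem hxI ht), mul_add]
    have hP := H.isPrimitiveOn_weightedComp_const hG1 c ht
    have hPd : IsPrimitiveOn a b (fun x => weightedComp φ (fun _ => c) t
        (fun x => ∫ s in a..x, v s) x + Real.exp (t * c) * d) (pullbackDeriv F φ c t v) :=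
      ⟨hP.1, fun x hx y hy => by rw [← hP.2 x hx y hy]; ring⟩
    rw [sobolevENorm_congr_ae h4]
    refine hPd.isWeakDeriv.sobolevENorm_le.trans ?_
    have h5 : eLpNorm (weightedComp φ (fun _ => c) t (fun x => ∫ s in a..x, v s))
          (ENNReal.ofReal p) (volume.restrict (Ioo a b)) +
        eLpNorm (pullbackDeriv F φ c t v) (ENNReal.ofReal p) (volume.restrict (Ioo a b)) ≤
        sobolevENorm (Ioo a b) (ENNReal.ofReal p)
          (weightedComp φ (fun _ => c) t (fun x => ∫ s in a..x, v s)) :=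
      le_iInf₂ fun v' h' => by rw [eLpNorm_congr_ae (hP.isWeakDeriv.ae_eq h')]
    rw [← hnorm]
    refine le_trans ?_ (add_le_add_left h5 _)
    rw [add_right_comm]
    refine add_le_add_left ?_ _
    exact eLpNorm_add_le (hP.continuousOn.aestronglyMeasurable measurableSet_Ioo)
      aestronglyMeasurable_const hq1

end IsRegularSemiflow

/-! ### The characterization of stability -/

theorem theorem4 (a b : ℝ) (hab : a < b) (p : ℝ) (hp : 1 ≤ p)
    (F : ℝ → ℝ) (hF : ContDiffOn ℝ 1 F (Icc a b)) (hFa : F a = 0)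
    (hF0 : ∀ x ∈ Ioo a b, F x ≠ 0)
    (φ : ℝ → ℝ → ℝ) (hφ : IsSemiflowOf F (Ioo a b) φ)
    (h : ℝ → ℝ) (hcont : ContinuousOn h (Icc a b)) (hW : MemSobolev (Ioo a b) ⊤ h)
    (hbdd : MemLp (fun y => (h y - h a) / F y) ⊤ (volume.restrict (Ioo a b))) :
    ((∀ t : ℝ, 0 < t → φ t '' Ioo a b = Ioo a b) →
      (StableOnSobolevStar a b (ENNReal.ofReal p) φ h ↔
        (∃ C : ℝ, ∀ᵐ y ∂(volume.restrict (Ioo a b)), ∀ t : ℝ, 0 ≤ t →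
          sobolevExponent a p F h y (φ t y) ≤ C) ∧
        (∀ y ∈ Ioo a b, Tendsto
          (fun t : ℝ => sobolevExponent a p F h (backFlow φ (Ioo a b) t y) y) atTop atBot)) ∧
      (StableOnSobolevStar a b (ENNReal.ofReal p) φ h →
        ∀ y ∈ Ioo a b, Tendsto
          (fun t : ℝ => sobolevExponent a p F h y (φ t y)) atTop atBot)) ∧
    ((∀ x ∈ Ioo a b, ∃ t : ℝ, 0 < t ∧ x ∉ φ t '' Ioo a b) →
      (StableOnSobolevStar a b (ENNReal.ofReal p) φ h ↔
        ∃ C : ℝ, ∀ᵐ y ∂(volume.restrict (Ioo a b)), ∀ t : ℝ, 0 ≤ t →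
          sobolevExponent a p F h y (φ t y) ≤ C)) ∧
    (StableOnSobolev a b (ENNReal.ofReal p) φ h ↔
      StableOnSobolevStar a b (ENNReal.ofReal p) φ h ∧ h a < 0) := by
  have H : IsRegularSemiflow a b F φ := ⟨hab, hF, hFa, hF0, hφ⟩
  have hq1 : (1 : ENNReal) ≤ ENNReal.ofReal p := by simpa using ENNReal.ofReal_le_ofReal hp
  obtain ⟨hS, hS'⟩ := H.stable_iff_stable_const hq1 hcont hbdd
  rw [hS, hS', H.stableOnSobolevStar_const_iff hp h, H.stableOnSobolev_const_iff hp (h a),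
    H.stableOnSobolevStar_const_iff hp h]
  have hbound : FlowWeightDecay a b p F φ h → ∃ C : ℝ, ∀ᵐ y ∂(volume.restrict (Ioo a b)),
      ∀ t : ℝ, 0 ≤ t → sobolevExponent a p F h y (φ t y) ≤ C := fun hW => by
    obtain ⟨C, hC⟩ := H.exists_bound_of_flowWeightDecay hp hW
    exact ⟨C, (ae_restrict_mem measurableSet_Ioo).mono hC⟩
  refine ⟨fun hsurj => ?_, fun hesc => ⟨hbound, ?_⟩, Iff.rfl⟩
  · have hlim : FlowWeightDecay a b p F φ h → ∀ y ∈ Ioo a b, Tendsto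
        (fun t : ℝ => sobolevExponent a p F h (backFlow φ (Ioo a b) t y) y) atTop atBot :=
      fun hW y hy => (IsRegularSemiflow.tendsto_flowWeight_iff hsurj hy).1
        (H.tendsto_flowWeight_of_flowWeightDecay hp hW hsurj hy)
    refine ⟨⟨fun hW => ⟨hbound hW, hlim hW⟩, ?_⟩, fun hW y hy =>
      H.tendsto_sobolevExponent_flow hp hsurj hy (hlim hW y hy)⟩
    rintro ⟨⟨C, hC⟩, h0⟩
    exact H.flowWeightDecay_of_bound hp (H.forall_sobolevExponent_le_of_ae hC) fun y hy =>
      (IsRegularSemiflow.tendsto_flowWeight_iff hsurj hy).2 (h0 y hy)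
  · rintro ⟨C, hC⟩
    refine H.flowWeightDecay_of_bound hp (H.forall_sobolevExponent_le_of_ae hC) fun y hy => ?_
    obtain ⟨t, ht, hyt⟩ := hesc y hy
    exact H.tendsto_flowWeight_of_not_mem p h ht.le hyt
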